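/- For $0\le\kappa\le 1$ let $T_\kappa$ be the paired tent map on $[-1,1]$: $T_\kappa(x)=2(1+\kappa)(x+1)-1$ on $[-1,-\tfrac12]$, $-2(1+\kappa)x-1$ on $[-\tfrac12,0)$, $T_\kappa(0)=0$, $-2(1+\kappa)x+1$ on $(0,\tfrac12]$, and $2(1+\kappa)(x-1)+1$ on $[\tfrac12,1]$. Let $\tilde T_\kappa=|T_\kappa|:[0,1]\to[0,1]$. For $n\ge 1$ let $\kappa_n\in(0,\tfrac12)$ be the unique positive solution of $(2+2\kappa)^n\kappa=1$, and put $\tilde T_n=\tilde T_{\kappa_n}$. Let $P_n$ be the Perron–Frobenius operator of $\tilde T_n$ on $L^1([0,1];\mathbb C)$ (Lebesgue measure), that is, $P_nf$ is the Radon–Nikodym derivative of $A\mapsto\int_{\tilde T_n^{-1}(A)}f\,dx$. Let $BV\subset L^1$ be the space of classes having a representative of bounded variation on $[0,1]$, with norm $\|f\|_{BV}=\|f\|_1+\mathrm{Var}(f)$, where $\mathrm{Var}(f)$ is the infimum of the variations of the representatives of $f$. Put $$\beta_n=\frac{1+1/n}{2+2\kappa_n}.$$ Then $P_n(BV)\subseteq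 BV$, and the following hold, where the spectrum and eigenvalues of $P_n$ are those of its restriction to $BV$. 1. For every $n\ge 6$, the number $1$ is an algebraically simple eigenvalue of $P_n$, with an eigenvector $h_n\in BV$ that is a probability density. Every other element of the spectrum of $P_n$, in particular every other eigenvalue, has modulus at most $\beta_n$; so the second-largest modulus in the spectrum, $\rho_n=\sup\{|z| : z\in\sigma(P_n),\ z\ne 1\}$, satisfies $\rho_n\le\beta_n$. 2. $\beta_n\sim\tfrac12\left(1+\tfrac1n\right)$ as $n\to\infty$, that is, the quotient of the two sides tends to $1$. 3. The mixing time is $O(1)$: the mixing time of $\tilde T_n$ (up to a scale factor), $1/|\log\rho_n|$, is bounded by a constant independent of $n\ge 6$. Moreover, for every $n\ge 6$ there is a constant $C_n$ such that, for all $f\in BV$ and $k\ge 0$, $$\Big\|P_n^kf-\Big(\int_0^1 f\,dx\Big)h_n\Big\|_1\le C_n\,\beta_n^{\,k}\,\|f\|_{BV}.$$ -/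

import Mathlib

open MeasureTheory Set

/-- The paired tent map `T_κ` on `[-1, 1]` (values outside `[-1, 1]` are irrelevant). -/
noncomputable def pairedTent (κ x : ℝ) : ℝ :=
  if x = 0 then 0
  else if x ≤ -(1 / 2) then 2 * (1 + κ) * (x + 1) - 1
  else if x < 0 then -2 * (1 + κ) * x - 1
  else if x ≤ 1 / 2 then -2 * (1 + κ) * x + 1
  else 2 * (1 + κ) * (x - 1) + 1

/-- The factor map `x ↦ |T_κ x|` on `[0, 1]`. -/
noncomputable def factorTent (κ x : ℝ) : ℝ := |pairedTent κ x|

theorem exists_kappa (n : ℕ) : ∃ x : ℝ, 0 < x ∧ (2 + 2 * x) ^ n * x = 1 := by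
  have hc : ContinuousOn (fun x : ℝ => (2 + 2 * x) ^ n * x) (Icc 0 1) := by fun_prop
  have h1 : (1 : ℝ) ∈ Icc ((2 + 2 * (0 : ℝ)) ^ n * 0) ((2 + 2 * (1 : ℝ)) ^ n * 1) := by
    constructor
    · simp
    · rw [mul_one]
      exact one_le_pow₀ (by norm_num)
  obtain ⟨x, hx, hx1⟩ := intermediate_value_Icc (zero_le_one) hc h1
  refine ⟨x, lt_of_le_of_ne hx.1 ?_, hx1⟩
  rintro rfl
  simp at hx1

/-- The parameter `κ_n`: the unique positive solution of `(2 + 2 κ) ^ n * κ = 1`. -/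
noncomputable def kappa (n : ℕ) : ℝ := (exists_kappa n).choose

theorem kappa_pos (n : ℕ) : 0 < kappa n := (exists_kappa n).choose_spec.1

theorem kappa_eq (n : ℕ) : (2 + 2 * kappa n) ^ n * kappa n = 1 := (exists_kappa n).choose_spec.2

theorem eq_kappa {n : ℕ} {x : ℝ} (hx : 0 < x) (h : (2 + 2 * x) ^ n * x = 1) : x = kappa n := by
  have key : ∀ a b : ℝ, 0 < a → a < b → (2 + 2 * a) ^ n * a < (2 + 2 * b) ^ n * b := by
    intro a b ha hab
    have h1 : (2 + 2 * a) ^ n ≤ (2 + 2 * b) ^ n := by gcongr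
    have h2 : 0 < (2 + 2 * b) ^ n := by have : 0 < b := ha.trans hab; positivity
    nlinarith [mul_le_mul_of_nonneg_right h1 ha.le, mul_lt_mul_of_pos_left hab h2]
  rcases lt_trichotomy x (kappa n) with hlt | heq | hgt
  · have := key _ _ hx hlt
    rw [h, kappa_eq] at this
    exact absurd this (lt_irrefl _)
  · exact heq
  · have := key _ _ (kappa_pos n) hgt
    rw [h, kappa_eq] at this
    exact absurd this (lt_irrefl _)

theorem kappa_le_one (n : ℕ) : kappa n ≤ 1 := by
  have h1 : 1 ≤ (2 + 2 * kappa n) ^ n := one_le_pow₀ (by linarith [kappa_pos n])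
  nlinarith [kappa_pos n, kappa_eq n]

theorem kappa_lt_half {n : ℕ} (hn : 1 ≤ n) : kappa n < 1 / 2 := by
  by_contra hk
  push Not at hk
  have h1 : (2 + 2 * kappa n) ^ 1 ≤ (2 + 2 * kappa n) ^ n :=
    pow_le_pow_right₀ (by linarith) hn
  nlinarith [kappa_eq n, mul_le_mul_of_nonneg_right h1 (kappa_pos n).le]

/-- Lebesgue measure on `[0, 1]`. -/
noncomputable def lebI : Measure ℝ := volume.restrict (Icc 0 1)

instance : IsProbabilityMeasure lebI := ⟨by simp [lebI]⟩

/-- The action of the Perron-Frobenius operator of a non-singular map `T`: `f ∈ L¹(μ)` is sent to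
the Radon-Nikodym derivative with respect to `μ` of the complex measure `A ↦ ∫_{T⁻¹ A} f dμ`. -/
noncomputable def pfFun {α : Type*} [MeasurableSpace α] (μ : Measure α) (T : α → α)
    (f : Lp ℂ 1 μ) : Lp ℂ 1 μ :=
  (ComplexMeasure.integrable_rnDeriv ((μ.withDensityᵥ f).map T) μ).toL1

theorem setIntegral_pfFun {α : Type*} [MeasurableSpace α] {μ : Measure α} [IsFiniteMeasure μ]
    {T : α → α} (hT : Measure.QuasiMeasurePreserving T μ μ) (f : Lp ℂ 1 μ) {A : Set α}
    (hA : MeasurableSet A) :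
    ∫ x in A, pfFun μ T f x ∂μ = ∫ x in T ⁻¹' A, f x ∂μ := by
  have hf : Integrable f μ := L1.integrable_coeFn f
  set c : ComplexMeasure α := (μ.withDensityᵥ f).map T with hc
  have hzero : ∀ s, MeasurableSet s → μ s = 0 → c s = 0 := by
    intro s hs h0
    rw [hc, VectorMeasure.map_apply _ hT.measurable hs,
      withDensityᵥ_apply hf (hT.measurable hs)]
    exact setIntegral_measure_zero _ (hT.preimage_null h0)
  have hac : ∀ s : SignedMeasure α, (∀ t, MeasurableSet t → μ t = 0 → s t = 0) →
      μ.withDensityᵥ (s.rnDeriv μ) = s := by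
    intro s hs
    apply SignedMeasure.withDensityᵥ_rnDeriv_eq
    intro t ht
    by_cases hm : MeasurableSet t
    · rw [Measure.toENNRealVectorMeasure_apply_measurable hm] at ht
      exact hs t hm ht
    · exact s.not_measurable hm
  have hre := hac (ComplexMeasure.re c) (fun t ht h0 => by
    have : (ComplexMeasure.re c) t = (c t).re := rfl
    rw [this, hzero t ht h0, Complex.zero_re])
  have him := hac (ComplexMeasure.im c) (fun t ht h0 => by
    have : (ComplexMeasure.im c) t = (c t).im := rfl
    rw [this, hzero t ht h0, Complex.zero_im])
  have hint := c.integrable_rnDeriv μ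
  have h1 : ∫ x in A, pfFun μ T f x ∂μ = ∫ x in A, c.rnDeriv μ x ∂μ :=
    setIntegral_congr_ae hA ((Integrable.coeFn_toL1 hint).mono fun x hx _ => hx)
  have h2 : ∫ x in A, c.rnDeriv μ x ∂μ = c A := by
    apply Complex.ext
    · rw [← RCLike.re_eq_complex_re, ← integral_re hint.integrableOn]
      have := congrArg (fun v : SignedMeasure α => v A) hre
      simp only [withDensityᵥ_apply (SignedMeasure.integrable_rnDeriv _ _) hA] at this
      exact this
    · rw [← RCLike.im_eq_complex_im, ← integral_im hint.integrableOn]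
      have := congrArg (fun v : SignedMeasure α => v A) him
      simp only [withDensityᵥ_apply (SignedMeasure.integrable_rnDeriv _ _) hA] at this
      exact this
  rw [h1, h2, hc, VectorMeasure.map_apply _ hT.measurable hA,
    withDensityᵥ_apply hf (hT.measurable hA)]

theorem eq_pfFun {α : Type*} [MeasurableSpace α] {μ : Measure α} [IsFiniteMeasure μ]
    {T : α → α} (hT : Measure.QuasiMeasurePreserving T μ μ) (f g : Lp ℂ 1 μ)
    (h : ∀ A, MeasurableSet A → ∫ x in A, g x ∂μ = ∫ x in T ⁻¹' A, f x ∂μ) :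
    g = pfFun μ T f := by
  apply Lp.ext
  apply (L1.integrable_coeFn g).ae_eq_of_forall_setIntegral_eq _ _ (L1.integrable_coeFn _)
  intro s hs _
  rw [h s hs, setIntegral_pfFun hT f hs]

/-- The Perron-Frobenius operator of a non-singular map, as a linear map of `L¹(μ)`. -/
noncomputable def perronFrobenius {α : Type*} [MeasurableSpace α] {μ : Measure α}
    [IsFiniteMeasure μ] {T : α → α} (hT : Measure.QuasiMeasurePreserving T μ μ) :
    Module.End ℂ (Lp ℂ 1 μ) where
  toFun := pfFun μ T
  map_add' f g := by
    symm
    apply eq_pfFun hT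
    intro A hA
    have e1 : ∀ u v : Lp ℂ 1 μ, ∀ B, MeasurableSet B →
        ∫ x in B, (u + v : Lp ℂ 1 μ) x ∂μ = ∫ x in B, u x ∂μ + ∫ x in B, v x ∂μ := by
      intro u v B hB
      rw [← integral_add (L1.integrable_coeFn u).integrableOn (L1.integrable_coeFn v).integrableOn]
      exact setIntegral_congr_ae hB ((Lp.coeFn_add u v).mono fun x hx _ => hx)
    rw [e1 _ _ _ hA, e1 _ _ _ (hT.measurable hA), setIntegral_pfFun hT f hA,
      setIntegral_pfFun hT g hA]
  map_smul' c f := by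
    symm
    apply eq_pfFun hT
    intro A hA
    have e1 : ∀ u : Lp ℂ 1 μ, ∀ B, MeasurableSet B →
        ∫ x in B, (c • u : Lp ℂ 1 μ) x ∂μ = c • ∫ x in B, u x ∂μ := by
      intro u B hB
      rw [← integral_smul]
      exact setIntegral_congr_ae hB ((Lp.coeFn_smul c u).mono fun x hx _ => hx)
    rw [RingHom.id_apply, e1 _ _ hA, e1 _ _ (hT.measurable hA), setIntegral_pfFun hT f hA]

theorem measurable_factorTent (κ : ℝ) : Measurable (factorTent κ) := by
  have : Measurable (pairedTent κ) := by
    unfold pairedTent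
    refine Measurable.ite (measurableSet_singleton 0) measurable_const ?_
    refine Measurable.ite measurableSet_Iic (by fun_prop) ?_
    refine Measurable.ite measurableSet_Iio (by fun_prop) ?_
    exact Measurable.ite measurableSet_Iic (by fun_prop) (by fun_prop)
  have h2 := continuous_abs.measurable.comp this
  exact h2

theorem factorTent_mem {κ : ℝ} (h0 : 0 ≤ κ) (h1 : κ ≤ 1) {x : ℝ} (hx : x ∈ Icc (0 : ℝ) 1) :
    factorTent κ x ∈ Icc (0 : ℝ) 1 := by
  refine ⟨abs_nonneg _, ?_⟩
  obtain ⟨hx0, hx1⟩ := hx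
  unfold factorTent pairedTent
  rw [abs_le]
  split_ifs <;> constructor <;> nlinarith

/-- The factor map is non-singular with respect to Lebesgue measure on `[0, 1]`. -/
theorem factorTent_nonsingular {κ : ℝ} (h0 : 0 ≤ κ) (h1 : κ ≤ 1) :
    Measure.QuasiMeasurePreserving (factorTent κ) lebI lebI := by
  refine ⟨measurable_factorTent κ, ?_⟩
  refine Measure.AbsolutelyContinuous.mk fun A hA hA0 => ?_
  rw [Measure.map_apply (measurable_factorTent κ) hA]
  unfold lebI at hA0 ⊢
  rw [Measure.restrict_apply hA] at hA0
  rw [Measure.restrict_apply (measurable_factorTent κ hA)]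
  have aff : ∀ a b : ℝ, a ≠ 0 → volume ((fun x : ℝ => a * x + b) ⁻¹' (A ∩ Icc 0 1)) = 0 := by
    intro a b ha
    have : (fun x : ℝ => a * x + b) ⁻¹' (A ∩ Icc 0 1) =
        (fun x : ℝ => a * x) ⁻¹' ((fun x : ℝ => x + b) ⁻¹' (A ∩ Icc 0 1)) := rfl
    rw [this, Real.volume_preimage_mul_left ha, measure_preimage_add_right, hA0, mul_zero]
  have hs : 2 * (1 + κ) ≠ 0 := by positivity
  have hs' : -(2 * (1 + κ)) ≠ 0 := neg_ne_zero.2 hs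
  have hsub : factorTent κ ⁻¹' A ∩ Icc 0 1 ⊆
      {0} ∪ ((fun x : ℝ => -(2 * (1 + κ)) * x + 1) ⁻¹' (A ∩ Icc 0 1) ∪
        (fun x : ℝ => 2 * (1 + κ) * x + -1) ⁻¹' (A ∩ Icc 0 1) ∪
        (fun x : ℝ => 2 * (1 + κ) * x + (1 - 2 * (1 + κ))) ⁻¹' (A ∩ Icc 0 1) ∪
        (fun x : ℝ => -(2 * (1 + κ)) * x + (2 * (1 + κ) - 1)) ⁻¹' (A ∩ Icc 0 1)) := by
    rintro x ⟨hxA, hx⟩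
    have hm : factorTent κ x ∈ A ∩ Icc 0 1 := ⟨hxA, factorTent_mem h0 h1 hx⟩
    by_cases hx0 : x = 0
    · exact Or.inl hx0
    right
    have hpos : 0 < x := lt_of_le_of_ne hx.1 (Ne.symm hx0)
    unfold factorTent pairedTent at hm
    rw [if_neg hx0, if_neg (by linarith), if_neg (by linarith)] at hm
    simp only [mem_union, mem_preimage]
    split_ifs at hm
    · rcases abs_choice (-2 * (1 + κ) * x + 1) with h | h <;> rw [h] at hm
      · left; left; left; convert hm using 1; ring
      · left; left; right; convert hm using 1; ring
    · rcases abs_choice (2 * (1 + κ) * (x - 1) + 1) with h | h <;> rw [h] at hm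
      · left; right; convert hm using 1; ring
      · right; convert hm using 1; ring
  refine measure_mono_null hsub ?_
  simp only [measure_union_null_iff, aff _ _ hs, aff _ _ hs', and_self, and_true]
  simp

/-- The Perron-Frobenius operator on `L¹([0, 1])` of the factor map with parameter `κ_n`. -/
noncomputable def factorPF (n : ℕ) : Module.End ℂ (Lp ℂ 1 lebI) :=
  perronFrobenius (factorTent_nonsingular (kappa_pos n).le (kappa_le_one n))

theorem BoundedVariationOn.add_fun {f g : ℝ → ℂ} {s : Set ℝ} (hf : BoundedVariationOn f s)
    (hg : BoundedVariationOn g s) : BoundedVariationOn (f + g) s := by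
  have : eVariationOn (f + g) s ≤ eVariationOn f s + eVariationOn g s := by
    apply iSup_le
    rintro ⟨m, u, hu, hus⟩
    calc ∑ i ∈ Finset.range m, edist ((f + g) (u (i + 1))) ((f + g) (u i))
        ≤ ∑ i ∈ Finset.range m, (edist (f (u (i + 1))) (f (u i)) +
            edist (g (u (i + 1))) (g (u i))) :=
          Finset.sum_le_sum fun i _ => edist_add_add_le _ _ _ _
      _ ≤ _ := by
          rw [Finset.sum_add_distrib]
          exact add_le_add (eVariationOn.sum_le hu hus) (eVariationOn.sum_le hu hus)
  exact ne_top_of_le_ne_top (ENNReal.add_ne_top.2 ⟨hf, hg⟩) this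

theorem BoundedVariationOn.const_smul_fun {f : ℝ → ℂ} {s : Set ℝ} (c : ℂ)
    (hf : BoundedVariationOn f s) : BoundedVariationOn (c • f) s := by
  have h := ((lipschitzWith_smul (β := ℂ) c).lipschitzOnWith
    (s := univ)).comp_eVariationOn_le (g := f) (s := s) (fun _ _ => mem_univ _)
  exact ne_top_of_le_ne_top (ENNReal.mul_ne_top ENNReal.coe_ne_top hf) h

/-- The space `BV`: the classes in `L¹([0, 1])` that have a representative of bounded variation
on `[0, 1]`. -/
def bvSpace : Submodule ℂ (Lp ℂ 1 lebI) where
  carrier := {f | ∃ g : ℝ → ℂ, f =ᵐ[lebI] g ∧ BoundedVariationOn g (Icc 0 1)}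
  add_mem' := by
    rintro f f' ⟨g, hg, hv⟩ ⟨g', hg', hv'⟩
    exact ⟨g + g', (Lp.coeFn_add f f').trans (hg.add hg'), hv.add_fun hv'⟩
  zero_mem' := ⟨0, Lp.coeFn_zero _ _ _, by
    simp [BoundedVariationOn, eVariationOn, edist_self]⟩
  smul_mem' := by
    rintro c f ⟨g, hg, hv⟩
    exact ⟨c • g, (Lp.coeFn_smul c f).trans (hg.const_smul c), hv.const_smul_fun c⟩

/-- The `BV` norm `‖f‖₁ + Var f`, where `Var f` is the least variation over all
representatives of `f`. -/
noncomputable def bvNorm (f : Lp ℂ 1 lebI) : ℝ :=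
  ‖f‖ + (⨅ (g : ℝ → ℂ) (_ : f =ᵐ[lebI] g), eVariationOn g (Icc 0 1)).toReal

/-- The second-largest modulus in the spectrum: the supremum of the moduli of the spectral
values other than `1`. -/
noncomputable def secondModulus {X : Type*} [AddCommGroup X] [Module ℂ X]
    (Q : Module.End ℂ X) : ℝ :=
  sSup {r : ℝ | ∃ z ∈ spectrum ℂ Q, z ≠ 1 ∧ r = ‖z‖}

/-- The mixing time (up to a scale factor) `1 / |log ρ|`, where `ρ` is the second-largest
modulus in the spectrum. -/
noncomputable def mixingTime {X : Type*} [AddCommGroup X] [Module ℂ X]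
    (Q : Module.End ℂ X) : ℝ :=
  1 / |Real.log (secondModulus Q)|

open Polynomial in
/-- Orbits of a linear map annihilated by a product of linear factors grow at most like `R ^ m`
if all roots have modulus less than `R`. -/
theorem exists_norm_pow_le_of_aeval_prod {E : Type*} [NormedAddCommGroup E] [NormedSpace ℂ E]
    (T : Module.End ℂ E) {R : ℝ} (hR : 0 < R) (s : Multiset ℂ) (hs : ∀ a ∈ s, ‖a‖ < R) (v : E)
    (hv : aeval T (s.map fun a => X - C a).prod v = 0) :
    ∃ K : ℝ, 0 ≤ K ∧ ∀ m : ℕ, ‖(T ^ m) v‖ ≤ K * R ^ m := by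
  induction s using Multiset.induction_on generalizing v with
  | empty =>
    have hv0 : v = 0 := by simpa using hv
    exact ⟨0, le_rfl, fun m => by simp [hv0]⟩
  | cons a s ih =>
    have ha : ‖a‖ < R := hs a (Multiset.mem_cons_self a s)
    obtain ⟨K, hK, hb⟩ := ih (fun b hb => hs b (Multiset.mem_cons_of_mem hb)) (T v - a • v) (by
      rw [Multiset.map_cons, Multiset.prod_cons, mul_comm, map_mul, Module.End.mul_apply] at hv
      simpa [Module.algebraMap_end_apply] using hv)
    refine ⟨max ‖v‖ (K / (R - ‖a‖)), (norm_nonneg v).trans (le_max_left _ _), fun m => ?_⟩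
    set K' := max ‖v‖ (K / (R - ‖a‖))
    have hK' : K ≤ K' * (R - ‖a‖) := (div_le_iff₀ (sub_pos.2 ha)).1 (le_max_right _ _)
    induction m with
    | zero => rw [pow_zero, pow_zero, mul_one]; exact le_max_left _ _
    | succ m ihm =>
      have e : (T ^ (m + 1)) v = a • (T ^ m) v + (T ^ m) (T v - a • v) := by
        rw [pow_succ, Module.End.mul_apply, map_sub, map_smul]
        abel
      calc ‖(T ^ (m + 1)) v‖ ≤ ‖a‖ * ‖(T ^ m) v‖ + ‖(T ^ m) (T v - a • v)‖ := by
            rw [e, ← norm_smul]; exact norm_add_le _ _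
        _ ≤ ‖a‖ * (K' * R ^ m) + K' * (R - ‖a‖) * R ^ m := by
            gcongr
            exact (hb m).trans (by gcongr)
        _ = K' * R ^ (m + 1) := by ring

open Polynomial in
theorem exists_norm_pow_le_of_monic {E : Type*} [NormedAddCommGroup E] [NormedSpace ℂ E]
    (T : Module.End ℂ E) {R : ℝ} (hR : 0 < R) {q : ℂ[X]} (hq : q.Monic)
    (hs : ∀ a, q.eval a = 0 → ‖a‖ < R) (v : E) (hv : aeval T q v = 0) :
    ∃ K : ℝ, 0 ≤ K ∧ ∀ m : ℕ, ‖(T ^ m) v‖ ≤ K * R ^ m := by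
  refine exists_norm_pow_le_of_aeval_prod T hR q.roots (fun a ha => hs a ?_) v ?_
  · exact (mem_roots hq.ne_zero).1 ha
  · rwa [← (IsAlgClosed.splits q).eq_prod_roots_of_monic hq]

theorem one_add_mul_add_le_pow {x : ℝ} (hx : 0 ≤ x) (m : ℕ) :
    1 + m * x + m * (m - 1) / 2 * x ^ 2 ≤ (1 + x) ^ m := by
  induction m with
  | zero => simp
  | succ m ih =>
    have h : 0 ≤ (m : ℝ) * (m - 1) / 2 * x ^ 3 := by
      rcases Nat.eq_zero_or_pos m with rfl | hm
      · simp
      · have : (1 : ℝ) ≤ m := by exact_mod_cast hm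
        have : (0 : ℝ) ≤ m - 1 := by linarith
        positivity
    rw [pow_succ (1 + x)]
    push_cast
    nlinarith [mul_le_mul_of_nonneg_right ih (by linarith : 0 ≤ 1 + x)]

theorem norm_pow_sub_pow_le_mul {x y : ℂ} {a : ℝ} (hx : ‖x‖ ≤ a) (hy : ‖y‖ ≤ a) (n : ℕ) :
    ‖x ^ (n + 1) - y ^ (n + 1)‖ ≤ (n + 1) * a ^ n * ‖x - y‖ := by
  have ha : 0 ≤ a := (norm_nonneg x).trans hx
  induction n with
  | zero => simp
  | succ n ih =>
    have e : x ^ (n + 1 + 1) - y ^ (n + 1 + 1) =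
        x ^ (n + 1) * (x - y) + (x ^ (n + 1) - y ^ (n + 1)) * y := by ring
    calc ‖x ^ (n + 1 + 1) - y ^ (n + 1 + 1)‖
        ≤ ‖x‖ ^ (n + 1) * ‖x - y‖ + ‖x ^ (n + 1) - y ^ (n + 1)‖ * ‖y‖ := by
          rw [e, ← norm_pow, ← norm_mul, ← norm_mul]; exact norm_add_le _ _
      _ ≤ a ^ (n + 1) * ‖x - y‖ + (n + 1) * a ^ n * ‖x - y‖ * a := by gcongr
      _ = _ := by push_cast; ring

/-- A root of `X ^ (n + 1) - 2 X ^ n - 2` of modulus at least `1 + 1 / n` has modulus at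
least `17 / 10`. -/
theorem le_norm_of_root {n : ℕ} (hn : 6 ≤ n) {a : ℂ} (ha : a ^ (n + 1) = 2 * a ^ n + 2)
    (h : 1 + 1 / (n : ℝ) ≤ ‖a‖) : 17 / 10 ≤ ‖a‖ := by
  have hn' : (6 : ℝ) ≤ n := by exact_mod_cast hn
  have hinv : 1 / (n : ℝ) ≤ 1 / 6 := by gcongr
  have hinv0 : 0 ≤ 1 / (n : ℝ) := by positivity
  have hprod : ‖a‖ ^ n * ‖a - 2‖ = 2 := by
    rw [← norm_pow, ← norm_mul, show a ^ n * (a - 2) = 2 by linear_combination ha]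
    simp
  have htri : 2 - ‖a - 2‖ ≤ ‖a‖ := by
    have := norm_sub_norm_le (2 : ℂ) (2 - a)
    rw [sub_sub_cancel, norm_sub_rev 2 a] at this
    simpa using this
  have h0 : 29 / 12 ≤ ‖a‖ ^ n := by
    refine le_trans ?_ ((one_add_mul_add_le_pow hinv0 n).trans (by gcongr))
    have e : 1 + (n : ℝ) * (1 / n) + n * (n - 1) / 2 * (1 / n) ^ 2 = 2 + (1 - 1 / n) / 2 := by
      field_simp
      ring
    rw [e]
    linarith
  have step : ∀ b c : ℝ, 1 ≤ b → b ≤ ‖a‖ → 2 / b ^ 6 ≤ 2 - c → c ≤ ‖a‖ := by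
    intro b c hb hba hc
    have h1 : b ^ 6 ≤ ‖a‖ ^ n :=
      (pow_le_pow_right₀ hb hn).trans (by gcongr)
    have h2 : ‖a - 2‖ ≤ 2 / b ^ 6 := by
      rw [le_div_iff₀ (by positivity)]
      nlinarith [norm_nonneg (a - 2)]
    linarith
  have h1 : 117 / 100 ≤ ‖a‖ := by nlinarith [norm_nonneg (a - 2)]
  have h2 : 122 / 100 ≤ ‖a‖ := step (117 / 100) _ (by norm_num) h1 (by norm_num)
  have h3 : 139 / 100 ≤ ‖a‖ := step (122 / 100) _ (by norm_num) h2 (by norm_num)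
  exact step (139 / 100) _ (by norm_num) h3 (by norm_num)

theorem root_unique {n : ℕ} (hn : 6 ≤ n) {a b : ℂ} (ha : a ^ (n + 1) = 2 * a ^ n + 2)
    (hb : b ^ (n + 1) = 2 * b ^ n + 2) (h : 1 + 1 / (n : ℝ) ≤ ‖a‖)
    (h' : 1 + 1 / (n : ℝ) ≤ ‖b‖) : a = b := by
  have key : ∀ c : ℂ, c ^ (n + 1) = 2 * c ^ n + 2 → 17 / 10 ≤ ‖c‖ →
      c ≠ 0 ∧ ‖c⁻¹‖ ≤ 10 / 17 ∧ c = 2 + 2 * c⁻¹ ^ n := by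
    intro c hc hcn
    have hc0 : c ≠ 0 := by
      rintro rfl
      norm_num at hcn
    refine ⟨hc0, ?_, ?_⟩
    · rw [norm_inv, inv_le_comm₀ (by linarith) (by norm_num)]
      norm_num at hcn ⊢
      exact hcn
    · have : c ^ n ≠ 0 := pow_ne_zero _ hc0
      rw [inv_pow]
      field_simp
      linear_combination hc
  obtain ⟨ha0, ha1, ha2⟩ := key a ha (le_norm_of_root hn ha h)
  obtain ⟨hb0, hb1, hb2⟩ := key b hb (le_norm_of_root hn hb h')
  obtain ⟨m, rfl⟩ : ∃ m, n = m + 1 := ⟨n - 1, by omega⟩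
  have hm : 5 ≤ m := by omega
  have e : a⁻¹ - b⁻¹ = -(2 * a⁻¹ * b⁻¹ * (a⁻¹ ^ (m + 1) - b⁻¹ ^ (m + 1))) := by
    have e1 : a - b = 2 * (a⁻¹ ^ (m + 1) - b⁻¹ ^ (m + 1)) := by linear_combination ha2 - hb2
    rw [show -(2 * a⁻¹ * b⁻¹ * (a⁻¹ ^ (m + 1) - b⁻¹ ^ (m + 1))) =
      -(a⁻¹ * b⁻¹ * (2 * (a⁻¹ ^ (m + 1) - b⁻¹ ^ (m + 1)))) by ring, ← e1]
    field_simp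
    ring
  have hsmall : ((m : ℝ) + 1) * (10 / 17) ^ m ≤ 1 := by
    clear * - hm
    induction m, hm using Nat.le_induction with
    | base => norm_num
    | succ k hk ih =>
      have hk' : (5 : ℝ) ≤ k := by exact_mod_cast hk
      have : (0 : ℝ) < (10 / 17) ^ k := by positivity
      rw [pow_succ]
      push_cast
      nlinarith
  have hle : ‖a⁻¹ - b⁻¹‖ ≤ 2 * (10 / 17) * (10 / 17) * (1 * ‖a⁻¹ - b⁻¹‖) := by
    calc ‖a⁻¹ - b⁻¹‖ = 2 * ‖a⁻¹‖ * ‖b⁻¹‖ * ‖a⁻¹ ^ (m + 1) - b⁻¹ ^ (m + 1)‖ := by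
          conv_lhs => rw [e]
          rw [norm_neg, norm_mul, norm_mul, norm_mul]
          simp
      _ ≤ 2 * (10 / 17) * (10 / 17) * (1 * ‖a⁻¹ - b⁻¹‖) := by
          gcongr
          exact (norm_pow_sub_pow_le_mul ha1 hb1 m).trans (by gcongr)
  have hz : ‖a⁻¹ - b⁻¹‖ = 0 := by nlinarith [norm_nonneg (a⁻¹ - b⁻¹)]
  exact inv_injective (sub_eq_zero.1 (norm_eq_zero.1 hz))

/-- The symmetrisation of a function with respect to `x ↦ 1 - x`. -/
def reflSum (g : ℝ → ℂ) (x : ℝ) : ℂ := g x + g (1 - x)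

/-- The pointwise transfer operator of the factor map. -/
noncomputable def tentTransfer (κ : ℝ) (g : ℝ → ℂ) (y : ℝ) : ℂ :=
  ((2 + 2 * κ : ℝ) : ℂ)⁻¹ * (reflSum g ((1 - y) / (2 + 2 * κ)) +
    (Iio κ).indicator (fun y => reflSum g ((1 + y) / (2 + 2 * κ))) y)

theorem integral_lebI (g : ℝ → ℂ) : ∫ x, g x ∂lebI = ∫ x in (0 : ℝ)..1, g x := by
  rw [lebI, integral_Icc_eq_integral_Ioc, intervalIntegral.integral_of_le zero_le_one]

theorem setIntegral_lebI (g : ℝ → ℂ) {A : Set ℝ} (hA : MeasurableSet A) :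
    ∫ x in A, g x ∂lebI = ∫ x in (0 : ℝ)..1, A.indicator g x := by
  rw [← integral_lebI, integral_indicator hA]

theorem integrable_lebI_iff {g : ℝ → ℂ} :
    Integrable g lebI ↔ IntervalIntegrable g volume 0 1 := by
  rw [lebI, intervalIntegrable_iff_integrableOn_Icc_of_le zero_le_one]
  rfl

theorem intervalIntegrable_reflSum {g : ℝ → ℂ} (hg : IntervalIntegrable g volume 0 1) :
    IntervalIntegrable (reflSum g) volume 0 1 := by
  have h := hg.comp_sub_left 1
  simp only [sub_zero, sub_self] at h
  exact hg.add h.symm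

theorem IntervalIntegrable.indicator_set {g : ℝ → ℂ} {a b : ℝ}
    (hg : IntervalIntegrable g volume a b) {A : Set ℝ} (hA : MeasurableSet A) :
    IntervalIntegrable (A.indicator g) volume a b :=
  ⟨hg.1.indicator hA, hg.2.indicator hA⟩

theorem integral_eq_integral_reflSum {u : ℝ → ℂ} (hu : IntervalIntegrable u volume 0 1) :
    ∫ x in (0 : ℝ)..1, u x = ∫ x in (0 : ℝ)..(1 / 2), reflSum u x := by
  have h1 : IntervalIntegrable u volume 0 (1 / 2) :=
    hu.mono_set (by
      rw [uIcc_of_le (by norm_num), uIcc_of_le (by norm_num)]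
      exact Icc_subset_Icc (by norm_num) (by norm_num))
  have h2 : IntervalIntegrable u volume (1 / 2) 1 :=
    hu.mono_set (by
      rw [uIcc_of_le (by norm_num), uIcc_of_le (by norm_num)]
      exact Icc_subset_Icc (by norm_num) (by norm_num))
  have h3 : IntervalIntegrable (fun x => u (1 - x)) volume 0 (1 / 2) := by
    have := (h2.comp_sub_left 1).symm
    norm_num at this ⊢
    exact this
  unfold reflSum
  rw [intervalIntegral.integral_add h1 h3, intervalIntegral.integral_comp_sub_left]
  norm_num only
  norm_num at h1 h2
  rw [← intervalIntegral.integral_add_adjacent_intervals h1 h2]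

section Tent

variable {κ : ℝ}

theorem factorTent_eq_abs {x : ℝ} (hx : 0 < x) (hx' : x ≤ 1 / 2) :
    factorTent κ x = |1 - (2 + 2 * κ) * x| := by
  unfold factorTent pairedTent
  rw [if_neg hx.ne', if_neg (by linarith), if_neg (by linarith), if_pos hx']
  congr 1
  ring

theorem factorTent_one_sub {x : ℝ} (hx : 0 < x) (hx' : x ≤ 1 / 2) :
    factorTent κ (1 - x) = |1 - (2 + 2 * κ) * x| := by
  rcases hx'.eq_or_lt with rfl | h
  · rw [show (1 : ℝ) - 1 / 2 = 1 / 2 by norm_num, factorTent_eq_abs (by norm_num) le_rfl]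
  · unfold factorTent pairedTent
    rw [if_neg (by linarith), if_neg (by linarith), if_neg (by linarith), if_neg (by linarith)]
    congr 1
    ring

theorem intervalIntegrable_left (h0 : 0 ≤ κ) {w : ℝ → ℂ}
    (hw : IntervalIntegrable w volume 0 1) :
    IntervalIntegrable (fun y => w ((1 - y) / (2 + 2 * κ))) volume 0 1 := by
  have hs : (2 + 2 * κ) ≠ 0 := by positivity
  have h1 : IntervalIntegrable w volume 0 (1 / (2 + 2 * κ)) := by
    refine hw.mono_set ?_
    rw [uIcc_of_le (by positivity), uIcc_of_le zero_le_one]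
    refine Icc_subset_Icc le_rfl ?_
    rw [div_le_one (by positivity)]
    linarith
  have h2 := (h1.comp_mul_left (c := (2 + 2 * κ)⁻¹)).comp_sub_left 1
  have e : 1 - 1 / (2 + 2 * κ) / (2 + 2 * κ)⁻¹ = 0 := by field_simp; ring
  rw [e] at h2
  simpa [div_eq_mul_inv, mul_comm] using h2.symm

theorem intervalIntegrable_right (h0 : 0 ≤ κ) {w : ℝ → ℂ}
    (hw : IntervalIntegrable w volume 0 1) :
    IntervalIntegrable (fun y => w ((1 + y) / (2 + 2 * κ))) volume 0 κ := by
  have hs : (2 + 2 * κ) ≠ 0 := by positivity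
  have h1 : IntervalIntegrable w volume (1 / (2 + 2 * κ)) (1 / 2) := by
    have hle : 1 / (2 + 2 * κ) ≤ 1 / 2 := by gcongr; linarith
    refine hw.mono_set ?_
    rw [uIcc_of_le hle, uIcc_of_le zero_le_one]
    exact Icc_subset_Icc (by positivity) (by norm_num)
  have h2 := (h1.comp_mul_left (c := (2 + 2 * κ)⁻¹)).comp_add_left 1
  have e : (1 / 2) / (2 + 2 * κ)⁻¹ - 1 = κ := by field_simp; ring
  have e' : 1 / (2 + 2 * κ) / (2 + 2 * κ)⁻¹ - 1 = 0 := by field_simp; ring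
  rw [e, e'] at h2
  simpa [div_eq_mul_inv, mul_comm] using h2

theorem integral_Iio_indicator (h0 : 0 ≤ κ) (_ : κ ≤ 1) (F : ℝ → ℂ) :
    ∫ y in (0 : ℝ)..1, (Iio κ).indicator F y = ∫ y in (0 : ℝ)..κ, F y := by
  rw [intervalIntegral.integral_of_le zero_le_one, intervalIntegral.integral_of_le h0,
    setIntegral_indicator measurableSet_Iio, integral_Ioc_eq_integral_Ioo]
  congr 2
  ext x
  simp only [mem_inter_iff, mem_Ioc, mem_Iio, mem_Ioo]
  constructor
  · rintro ⟨h, h'⟩; exact ⟨h.1, h'⟩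
  · rintro ⟨h, h'⟩; exact ⟨⟨h, by linarith⟩, h'⟩

theorem intervalIntegrable_Iio_indicator (h0 : 0 ≤ κ) {F : ℝ → ℂ}
    (hF : IntervalIntegrable F volume 0 κ) :
    IntervalIntegrable ((Iio κ).indicator F) volume 0 1 := by
  rw [intervalIntegrable_iff_integrableOn_Ioo_of_le zero_le_one,
    integrableOn_indicator_iff measurableSet_Iio]
  rw [intervalIntegrable_iff_integrableOn_Ioo_of_le h0] at hF
  refine hF.mono_set ?_
  rintro x ⟨h, h'⟩
  simp only [mem_Ioo, mem_Iio] at *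
  tauto

theorem intervalIntegrable_tentTransfer (h0 : 0 ≤ κ) {g : ℝ → ℂ}
    (hg : IntervalIntegrable g volume 0 1) :
    IntervalIntegrable (tentTransfer κ g) volume 0 1 :=
  ((intervalIntegrable_left h0 (intervalIntegrable_reflSum hg)).add
    (intervalIntegrable_Iio_indicator h0
      (intervalIntegrable_right h0 (intervalIntegrable_reflSum hg)))).const_mul _

/-- Change of variables on the two monotone halves of `x ↦ |1 - (2 + 2 κ) x|` on `[0, 1/2]`. -/
theorem integral_abs_branch (h0 : 0 ≤ κ) {w : ℝ → ℂ} (hw : IntervalIntegrable w volume 0 1) :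
    (2 + 2 * κ : ℝ) * ∫ x in (0 : ℝ)..(1 / 2), w x =
      (∫ y in (0 : ℝ)..1, w ((1 - y) / (2 + 2 * κ))) +
        ∫ y in (0 : ℝ)..κ, w ((1 + y) / (2 + 2 * κ)) := by
  have hs : (2 + 2 * κ) ≠ 0 := by positivity
  have hle : 1 / (2 + 2 * κ) ≤ 1 / 2 := by gcongr; linarith
  have hpos : 0 ≤ 1 / (2 + 2 * κ) := by positivity
  have i1 : IntervalIntegrable w volume 0 (1 / (2 + 2 * κ)) := by
    refine hw.mono_set ?_
    rw [uIcc_of_le hpos, uIcc_of_le zero_le_one]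
    exact Icc_subset_Icc le_rfl (by linarith)
  have i2 : IntervalIntegrable w volume (1 / (2 + 2 * κ)) (1 / 2) := by
    refine hw.mono_set ?_
    rw [uIcc_of_le hle, uIcc_of_le zero_le_one]
    exact Icc_subset_Icc hpos (by norm_num)
  simp only [sub_div, add_div]
  rw [intervalIntegral.integral_comp_sub_div _ hs, intervalIntegral.integral_comp_add_div _ hs,
    ← intervalIntegral.integral_add_adjacent_intervals i1 i2,
    show 1 / (2 + 2 * κ) + κ / (2 + 2 * κ) = 1 / 2 by field_simp]
  simp only [zero_div, sub_zero, add_zero, sub_self, Complex.real_smul, mul_add]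

theorem integral_preimage_factorTent (h0 : 0 ≤ κ) (h1 : κ ≤ 1) {g : ℝ → ℂ}
    (hg : IntervalIntegrable g volume 0 1) {A : Set ℝ} (hA : MeasurableSet A) :
    ∫ x in (0 : ℝ)..1, (factorTent κ ⁻¹' A).indicator g x =
      ∫ y in (0 : ℝ)..1, A.indicator (tentTransfer κ g) y := by
  have hs : (2 + 2 * κ) ≠ 0 := by positivity
  have hs' : ((2 + 2 * κ : ℝ) : ℂ) ≠ 0 := by exact_mod_cast hs
  set B : Set ℝ := (fun x => |1 - (2 + 2 * κ) * x|) ⁻¹' A with hB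
  have hBm : MeasurableSet B :=
    (by fun_prop : Measurable fun x : ℝ => |1 - (2 + 2 * κ) * x|) hA
  have hG := intervalIntegrable_reflSum hg
  set w := B.indicator (reflSum g) with hw
  have hwi : IntervalIntegrable w volume 0 1 := hG.indicator_set hBm
  have e1 : ∫ x in (0 : ℝ)..1, (factorTent κ ⁻¹' A).indicator g x =
      ∫ x in (0 : ℝ)..(1 / 2), w x := by
    rw [integral_eq_integral_reflSum (hg.indicator_set (measurable_factorTent κ hA))]
    apply intervalIntegral.integral_congr_ae
    refine Filter.Eventually.of_forall fun x hx => ?_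
    rw [uIoc_of_le (by norm_num)] at hx
    by_cases hxB : |1 - (2 + 2 * κ) * x| ∈ A
    · rw [reflSum, hw, indicator_of_mem, indicator_of_mem, indicator_of_mem]
      · rfl
      · exact hxB
      · rw [mem_preimage, factorTent_one_sub hx.1 hx.2]; exact hxB
      · rw [mem_preimage, factorTent_eq_abs hx.1 hx.2]; exact hxB
    · rw [reflSum, hw, indicator_of_notMem, indicator_of_notMem, indicator_of_notMem, add_zero]
      · exact hxB
      · rw [mem_preimage, factorTent_one_sub hx.1 hx.2]; exact hxB
      · rw [mem_preimage, factorTent_eq_abs hx.1 hx.2]; exact hxB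
  have e2 : ∫ y in (0 : ℝ)..1, w ((1 - y) / (2 + 2 * κ)) =
      ∫ y in (0 : ℝ)..1, A.indicator (fun y => reflSum g ((1 - y) / (2 + 2 * κ))) y := by
    apply intervalIntegral.integral_congr
    intro y hy
    rw [uIcc_of_le zero_le_one] at hy
    have hm : (1 - y) / (2 + 2 * κ) ∈ B ↔ y ∈ A := by
      change |1 - (2 + 2 * κ) * ((1 - y) / (2 + 2 * κ))| ∈ A ↔ y ∈ A
      rw [mul_div_cancel₀ _ hs, sub_sub_cancel, abs_of_nonneg hy.1]
    by_cases hyA : y ∈ A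
    · simp only [hw, indicator_of_mem (hm.2 hyA), indicator_of_mem hyA]
    · simp only [hw, indicator_of_notMem (hm.not.2 hyA), indicator_of_notMem hyA]
  have e3 : ∫ y in (0 : ℝ)..κ, w ((1 + y) / (2 + 2 * κ)) =
      ∫ y in (0 : ℝ)..κ, A.indicator (fun y => reflSum g ((1 + y) / (2 + 2 * κ))) y := by
    apply intervalIntegral.integral_congr
    intro y hy
    rw [uIcc_of_le h0] at hy
    have hm : (1 + y) / (2 + 2 * κ) ∈ B ↔ y ∈ A := by
      change |1 - (2 + 2 * κ) * ((1 + y) / (2 + 2 * κ))| ∈ A ↔ y ∈ A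
      rw [mul_div_cancel₀ _ hs, sub_add_cancel_left, abs_neg, abs_of_nonneg hy.1]
    by_cases hyA : y ∈ A
    · simp only [hw, indicator_of_mem (hm.2 hyA), indicator_of_mem hyA]
    · simp only [hw, indicator_of_notMem (hm.not.2 hyA), indicator_of_notMem hyA]
  have e4 : A.indicator (tentTransfer κ g) = fun y => ((2 + 2 * κ : ℝ) : ℂ)⁻¹ *
      (A.indicator (fun y => reflSum g ((1 - y) / (2 + 2 * κ))) y +
        (Iio κ).indicator (A.indicator fun y => reflSum g ((1 + y) / (2 + 2 * κ))) y) := by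
    ext y
    by_cases hy : y ∈ A <;> by_cases hy' : y ∈ Iio κ <;> simp [tentTransfer, indicator, hy, hy']
  rw [e1, e4, intervalIntegral.integral_const_mul, intervalIntegral.integral_add,
    integral_Iio_indicator h0 h1, ← e2, ← e3, ← integral_abs_branch h0 hwi,
    inv_mul_cancel_left₀ hs']
  · exact (intervalIntegrable_left h0 hG).indicator_set hA
  · exact intervalIntegrable_Iio_indicator h0
      ((intervalIntegrable_right h0 hG).indicator_set hA)

/-- The Perron-Frobenius operator acts on representatives by `tentTransfer`. -/
theorem perronFrobenius_ae_eq (h0 : 0 ≤ κ) (h1 : κ ≤ 1) {f : Lp ℂ 1 lebI} {g : ℝ → ℂ}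
    (hfg : f =ᵐ[lebI] g) :
    perronFrobenius (factorTent_nonsingular h0 h1) f =ᵐ[lebI] tentTransfer κ g := by
  have hT := factorTent_nonsingular h0 h1
  have hg : IntervalIntegrable g volume 0 1 :=
    integrable_lebI_iff.1 ((L1.integrable_coeFn f).congr hfg)
  have hi : Integrable (tentTransfer κ g) lebI :=
    integrable_lebI_iff.2 (intervalIntegrable_tentTransfer h0 hg)
  have hae : hi.toL1 =ᵐ[lebI] tentTransfer κ g := hi.coeFn_toL1
  have : hi.toL1 = pfFun lebI (factorTent κ) f := by
    apply eq_pfFun hT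
    intro A hA
    rw [setIntegral_congr_ae hA (hae.mono fun x hx _ => hx),
      setIntegral_congr_ae (hT.measurable hA) (hfg.mono fun x hx _ => hx),
      setIntegral_lebI _ hA, setIntegral_lebI _ (hT.measurable hA),
      integral_preimage_factorTent h0 h1 hg hA]
  change pfFun lebI (factorTent κ) f =ᵐ[lebI] _
  rw [← this]
  exact hae

theorem integral_perronFrobenius (h0 : 0 ≤ κ) (h1 : κ ≤ 1) (f : Lp ℂ 1 lebI) :
    ∫ x, perronFrobenius (factorTent_nonsingular h0 h1) f x ∂lebI = ∫ x, f x ∂lebI := by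
  have h := setIntegral_pfFun (factorTent_nonsingular h0 h1) f MeasurableSet.univ
  rw [preimage_univ, setIntegral_univ, setIntegral_univ] at h
  exact h

end Tent

section Variation

variable {s : Set ℝ}

theorem eVariationOn_add_le (f g : ℝ → ℂ) :
    eVariationOn (fun x => f x + g x) s ≤ eVariationOn f s + eVariationOn g s := by
  apply iSup_le
  rintro ⟨m, u, hu, hus⟩
  calc ∑ i ∈ Finset.range m, edist (f (u (i + 1)) + g (u (i + 1))) (f (u i) + g (u i))
      ≤ ∑ i ∈ Finset.range m, (edist (f (u (i + 1))) (f (u i)) +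
          edist (g (u (i + 1))) (g (u i))) :=
        Finset.sum_le_sum fun i _ => edist_add_add_le _ _ _ _
    _ ≤ _ := by
        rw [Finset.sum_add_distrib]
        exact add_le_add (eVariationOn.sum_le hu hus) (eVariationOn.sum_le hu hus)

theorem eVariationOn_const_mul_le (c : ℂ) (f : ℝ → ℂ) :
    eVariationOn (fun x => c * f x) s ≤ ‖c‖ₑ * eVariationOn f s :=
  ((lipschitzWith_smul (β := ℂ) c).lipschitzOnWith (s := univ)).comp_eVariationOn_le
    (g := f) (s := s) (fun _ _ => mem_univ _)

theorem eVariationOn_sub_const (f : ℝ → ℂ) (c : ℂ) :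
    eVariationOn (fun x => f x - c) s = eVariationOn f s := by
  unfold eVariationOn
  simp only [edist_sub_right]

theorem eVariationOn_tsum_le {F : ℕ → ℝ → ℂ} (hF : ∀ x ∈ s, Summable fun k => F k x) :
    eVariationOn (fun x => ∑' k, F k x) s ≤ ∑' k, eVariationOn (F k) s := by
  apply iSup_le
  rintro ⟨m, u, hu, hus⟩
  calc ∑ i ∈ Finset.range m, edist (∑' k, F k (u (i + 1))) (∑' k, F k (u i))
      ≤ ∑ i ∈ Finset.range m, ∑' k, edist (F k (u (i + 1))) (F k (u i)) := by
        refine Finset.sum_le_sum fun i _ => ?_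
        rw [edist_eq_enorm_sub, ← (hF _ (hus _)).tsum_sub (hF _ (hus _))]
        refine enorm_tsum_le_tsum_enorm.trans_eq ?_
        simp only [edist_eq_enorm_sub]
    _ = ∑' k, ∑ i ∈ Finset.range m, edist (F k (u (i + 1))) (F k (u i)) :=
        (Summable.tsum_finsetSum fun _ _ => ENNReal.summable).symm
    _ ≤ _ := ENNReal.tsum_le_tsum fun k => eVariationOn.sum_le hu hus

theorem eVariationOn_Icc_add_Icc (f : ℝ → ℂ) {a b c : ℝ} (hab : a ≤ b) (hbc : b ≤ c) :
    eVariationOn f (Icc a b) + eVariationOn f (Icc b c) = eVariationOn f (Icc a c) := by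
  simpa using eVariationOn.Icc_add_Icc f (s := univ) hab hbc (mem_univ b)

theorem BoundedVariationOn.sub_const_fun {f : ℝ → ℂ} (hf : BoundedVariationOn f s) (c : ℂ) :
    BoundedVariationOn (fun x => f x - c) s := by
  rw [BoundedVariationOn, eVariationOn_sub_const]
  exact hf

theorem BoundedVariationOn.const_fun (c : ℂ) : BoundedVariationOn (fun _ : ℝ => c) s := by
  simp [BoundedVariationOn, eVariationOn, edist_self]

theorem BoundedVariationOn.aestronglyMeasurable_restrict {f : ℝ → ℂ}
    (hf : BoundedVariationOn f s) (hs : MeasurableSet s) :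
    AEStronglyMeasurable f (volume.restrict s) := by
  have real : ∀ g : ℝ → ℝ, BoundedVariationOn g s → AEMeasurable g (volume.restrict s) := by
    intro g hg
    obtain ⟨p, q, hp, hq, rfl⟩ :=
      hg.locallyBoundedVariationOn.exists_monotoneOn_sub_monotoneOn
    exact (aemeasurable_restrict_of_monotoneOn hs hp).sub
      (aemeasurable_restrict_of_monotoneOn hs hq)
  have hre : LipschitzWith 1 Complex.re :=
    LipschitzWith.of_dist_le_mul fun x y => by
      simpa [dist_eq_norm, Real.norm_eq_abs] using Complex.abs_re_le_norm (x - y)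
  have him : LipschitzWith 1 Complex.im :=
    LipschitzWith.of_dist_le_mul fun x y => by
      simpa [dist_eq_norm, Real.norm_eq_abs] using Complex.abs_im_le_norm (x - y)
  have h1 := real _ (hre.comp_boundedVariationOn hf)
  have h2 := real _ (him.comp_boundedVariationOn hf)
  have h3 := (Complex.measurable_ofReal.comp_aemeasurable h1).add
    ((Complex.measurable_ofReal.comp_aemeasurable h2).mul_const Complex.I)
  refine (h3.congr (Filter.Eventually.of_forall fun x => ?_)).aestronglyMeasurable
  simp [Complex.re_add_im]

theorem BoundedVariationOn.norm_le_of_eq_zero {f : ℝ → ℂ} (hf : BoundedVariationOn f s) {x y : ℝ}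
    (hx : x ∈ s) (hy : y ∈ s) (h0 : f y = 0) : ‖f x‖ ≤ (eVariationOn f s).toReal := by
  have := hf.dist_le hx hy
  rwa [h0, dist_zero_right] at this

end Variation

theorem BoundedVariationOn.integrable_lebI {g : ℝ → ℂ} (hg : BoundedVariationOn g (Icc 0 1)) :
    Integrable g lebI := by
  refine Integrable.of_bound (C := ‖g 0‖ + (eVariationOn g (Icc 0 1)).toReal)
    (hg.aestronglyMeasurable_restrict measurableSet_Icc) ?_
  refine ae_restrict_of_forall_mem measurableSet_Icc fun x hx => ?_
  have h := hg.dist_le hx (left_mem_Icc.2 zero_le_one)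
  rw [dist_eq_norm] at h
  calc ‖g x‖ = ‖g 0 + (g x - g 0)‖ := by rw [add_sub_cancel]
    _ ≤ _ := (norm_add_le _ _).trans (by gcongr)

/-- The transfer operator on functions whose value at `1/2` is zero, extended to all functions
so that no discontinuity is created at `κ`. -/
noncomputable def tentCont (κ : ℝ) (g : ℝ → ℂ) (y : ℝ) : ℂ :=
  ((2 + 2 * κ : ℝ) : ℂ)⁻¹ * (reflSum g ((1 - y) / (2 + 2 * κ)) +
    reflSum g (min ((1 + y) / (2 + 2 * κ)) (1 / 2)))

/-- `tentCont` normalised to vanish at `1/2`. -/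
noncomputable def tentNorm (κ : ℝ) (g : ℝ → ℂ) (y : ℝ) : ℂ :=
  tentCont κ g y - tentCont κ g (1 / 2)

section Tent

variable {κ : ℝ}

theorem tentTransfer_eq_tentCont (h0 : 0 ≤ κ) {g : ℝ → ℂ} (hg : g (1 / 2) = 0) :
    tentTransfer κ g = tentCont κ g := by
  have hs : (0 : ℝ) < 2 + 2 * κ := by positivity
  ext y
  unfold tentTransfer tentCont
  by_cases hy : y < κ
  · rw [indicator_of_mem (mem_Iio.2 hy), min_eq_left]
    rw [div_le_iff₀ hs]
    linarith
  · rw [indicator_of_notMem (by simpa using hy), min_eq_right]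
    · rw [reflSum, reflSum, show (1 : ℝ) - 1 / 2 = 1 / 2 by norm_num, hg]
      ring
    · rw [le_div_iff₀ hs]
      linarith

theorem eVariationOn_reflSum_le (g : ℝ → ℂ) :
    eVariationOn (reflSum g) (Icc 0 (1 / 2)) ≤ eVariationOn g (Icc 0 1) := by
  have h : eVariationOn (fun x => g (1 - x)) (Icc 0 (1 / 2)) ≤
      eVariationOn g (Icc (1 / 2) 1) := by
    refine eVariationOn.comp_le_of_antitoneOn g (fun x => 1 - x) ?_ ?_
    · intro x _ y _ hxy
      dsimp only
      linarith
    · intro x hx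
      rw [mem_Icc] at *
      constructor <;> linarith
  refine (eVariationOn_add_le g fun x => g (1 - x)).trans ?_
  rw [← eVariationOn_Icc_add_Icc g (by norm_num : (0 : ℝ) ≤ 1 / 2)
    (by norm_num : (1 / 2 : ℝ) ≤ 1)]
  exact add_le_add le_rfl h

theorem eVariationOn_tentCont_le (h0 : 0 ≤ κ) (g : ℝ → ℂ) :
    eVariationOn (tentCont κ g) (Icc 0 1) ≤
      ENNReal.ofReal (2 + 2 * κ)⁻¹ * eVariationOn g (Icc 0 1) := by
  have hs : (0 : ℝ) < 2 + 2 * κ := by positivity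
  have hle : 1 / (2 + 2 * κ) ≤ 1 / 2 := by gcongr; linarith
  have h1 : eVariationOn (fun y => reflSum g ((1 - y) / (2 + 2 * κ))) (Icc 0 1) ≤
      eVariationOn (reflSum g) (Icc 0 (1 / (2 + 2 * κ))) := by
    refine eVariationOn.comp_le_of_antitoneOn (reflSum g) (fun y => (1 - y) / (2 + 2 * κ)) ?_ ?_
    · intro x _ y _ hxy
      dsimp only
      gcongr
    · intro x hx
      have : 0 ≤ 1 - x := by linarith [hx.2]
      refine ⟨by positivity, ?_⟩
      dsimp only
      gcongr
      linarith [hx.1]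
  have h2 : eVariationOn (fun y => reflSum g (min ((1 + y) / (2 + 2 * κ)) (1 / 2))) (Icc 0 1) ≤
      eVariationOn (reflSum g) (Icc (1 / (2 + 2 * κ)) (1 / 2)) := by
    refine eVariationOn.comp_le_of_monotoneOn (reflSum g)
      (fun y => min ((1 + y) / (2 + 2 * κ)) (1 / 2)) ?_ ?_
    · intro x _ y _ hxy
      dsimp only
      gcongr
    · intro x hx
      refine ⟨le_min ?_ hle, min_le_right _ _⟩
      gcongr
      linarith [hx.1]
  have hc : ‖((2 + 2 * κ : ℝ) : ℂ)⁻¹‖ₑ = ENNReal.ofReal (2 + 2 * κ)⁻¹ := by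
    rw [← ofReal_norm, norm_inv, Complex.norm_of_nonneg hs.le]
  calc eVariationOn (tentCont κ g) (Icc 0 1) ≤ ‖((2 + 2 * κ : ℝ) : ℂ)⁻¹‖ₑ *
        eVariationOn (fun y => reflSum g ((1 - y) / (2 + 2 * κ)) +
          reflSum g (min ((1 + y) / (2 + 2 * κ)) (1 / 2))) (Icc 0 1) :=
        eVariationOn_const_mul_le _ _
    _ ≤ ENNReal.ofReal (2 + 2 * κ)⁻¹ * (eVariationOn (reflSum g) (Icc 0 (1 / (2 + 2 * κ))) +
          eVariationOn (reflSum g) (Icc (1 / (2 + 2 * κ)) (1 / 2))) := by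
        rw [hc]
        gcongr
        exact (eVariationOn_add_le _ _).trans (add_le_add h1 h2)
    _ ≤ _ := by
        rw [eVariationOn_Icc_add_Icc _ (by positivity) hle]
        gcongr
        exact eVariationOn_reflSum_le g

theorem tentNorm_half (g : ℝ → ℂ) : tentNorm κ g (1 / 2) = 0 := sub_self _

theorem eVariationOn_tentNorm_le (h0 : 0 ≤ κ) (g : ℝ → ℂ) :
    eVariationOn (tentNorm κ g) (Icc 0 1) ≤
      ENNReal.ofReal (2 + 2 * κ)⁻¹ * eVariationOn g (Icc 0 1) :=
  (eVariationOn_sub_const _ _).trans_le (eVariationOn_tentCont_le h0 g)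

theorem eVariationOn_iterate_tentNorm_le (h0 : 0 ≤ κ) (g : ℝ → ℂ) (k : ℕ) :
    eVariationOn ((tentNorm κ)^[k] g) (Icc 0 1) ≤
      ENNReal.ofReal ((2 + 2 * κ)⁻¹ ^ k) * eVariationOn g (Icc 0 1) := by
  induction k with
  | zero => simp
  | succ k ih =>
    rw [Function.iterate_succ_apply', pow_succ', ENNReal.ofReal_mul (by positivity), mul_assoc]
    exact (eVariationOn_tentNorm_le h0 _).trans (by gcongr)

theorem BoundedVariationOn.iterate_tentNorm (h0 : 0 ≤ κ) {g : ℝ → ℂ}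
    (hg : BoundedVariationOn g (Icc 0 1)) (k : ℕ) :
    BoundedVariationOn ((tentNorm κ)^[k] g) (Icc 0 1) :=
  ne_top_of_le_ne_top (ENNReal.mul_ne_top ENNReal.ofReal_ne_top hg)
    (eVariationOn_iterate_tentNorm_le h0 g k)

theorem iterate_tentNorm_half {g : ℝ → ℂ} (hg : g (1 / 2) = 0) (k : ℕ) :
    (tentNorm κ)^[k] g (1 / 2) = 0 := by
  cases k with
  | zero => exact hg
  | succ k => rw [Function.iterate_succ_apply']; exact tentNorm_half _

theorem norm_iterate_tentNorm_le (h0 : 0 ≤ κ) {g : ℝ → ℂ}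
    (hg : BoundedVariationOn g (Icc 0 1)) (hg0 : g (1 / 2) = 0) (k : ℕ) {y : ℝ}
    (hy : y ∈ Icc (0 : ℝ) 1) :
    ‖(tentNorm κ)^[k] g y‖ ≤ (2 + 2 * κ)⁻¹ ^ k * (eVariationOn g (Icc 0 1)).toReal := by
  have h := (hg.iterate_tentNorm h0 k).norm_le_of_eq_zero hy
    (by norm_num : (1 / 2 : ℝ) ∈ Icc (0 : ℝ) 1) (iterate_tentNorm_half hg0 k)
  refine h.trans ?_
  have := ENNReal.toReal_mono (ENNReal.mul_ne_top ENNReal.ofReal_ne_top hg)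
    (eVariationOn_iterate_tentNorm_le h0 g k)
  rwa [ENNReal.toReal_mul, ENNReal.toReal_ofReal (by positivity)] at this

theorem left_mem (h0 : 0 ≤ κ) {y : ℝ} (hy : y ∈ Icc (0 : ℝ) 1) :
    (1 - y) / (2 + 2 * κ) ∈ Icc (0 : ℝ) 1 := by
  have : 0 ≤ 1 - y := by linarith [hy.2]
  refine ⟨by positivity, ?_⟩
  rw [div_le_one (by positivity)]
  linarith [hy.1]

theorem right_mem (h0 : 0 ≤ κ) {y : ℝ} (hy : y ∈ Icc (0 : ℝ) 1) :
    min ((1 + y) / (2 + 2 * κ)) (1 / 2) ∈ Icc (0 : ℝ) 1 := by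
  have : 0 ≤ 1 + y := by linarith [hy.1]
  exact ⟨le_min (by positivity) (by norm_num), (min_le_right _ _).trans (by norm_num)⟩

theorem one_sub_mem {y : ℝ} (hy : y ∈ Icc (0 : ℝ) 1) : 1 - y ∈ Icc (0 : ℝ) 1 :=
  ⟨by linarith [hy.2], by linarith [hy.1]⟩

theorem norm_tentCont_le (h0 : 0 ≤ κ) {g : ℝ → ℂ} {M : ℝ}
    (hM : ∀ y ∈ Icc (0 : ℝ) 1, ‖g y‖ ≤ M) {y : ℝ} (hy : y ∈ Icc (0 : ℝ) 1) :
    ‖tentCont κ g y‖ ≤ 2 * M := by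
  have hs : (0 : ℝ) < 2 + 2 * κ := by positivity
  have hM0 : 0 ≤ M := (norm_nonneg _).trans (hM y hy)
  have hinv : (2 + 2 * κ)⁻¹ ≤ 2⁻¹ := by gcongr; linarith
  have hr : ∀ x ∈ Icc (0 : ℝ) 1, ‖reflSum g x‖ ≤ M + M := fun x hx =>
    (norm_add_le _ _).trans (add_le_add (hM _ hx) (hM _ (one_sub_mem hx)))
  rw [tentCont, norm_mul, norm_inv, Complex.norm_of_nonneg hs.le]
  calc (2 + 2 * κ)⁻¹ * _ ≤ 2⁻¹ * ((M + M) + (M + M)) := by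
        gcongr
        exact (norm_add_le _ _).trans (add_le_add (hr _ (left_mem h0 hy)) (hr _ (right_mem h0 hy)))
    _ = 2 * M := by ring

/-- `tentNorm` commutes with pointwise sums of series on `[0, 1]`. -/
theorem hasSum_tentNorm (h0 : 0 ≤ κ) {F : ℕ → ℝ → ℂ} {u : ℝ → ℂ}
    (hF : ∀ y ∈ Icc (0 : ℝ) 1, HasSum (fun k => F k y) (u y)) {y : ℝ}
    (hy : y ∈ Icc (0 : ℝ) 1) : HasSum (fun k => tentNorm κ (F k) y) (tentNorm κ u y) := by
  have hr : ∀ x ∈ Icc (0 : ℝ) 1, HasSum (fun k => reflSum (F k) x) (reflSum u x) := fun x hx =>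
    (hF _ hx).add (hF _ (one_sub_mem hx))
  have hc : ∀ x ∈ Icc (0 : ℝ) 1, HasSum (fun k => tentCont κ (F k) x) (tentCont κ u x) :=
    fun x hx => ((hr _ (left_mem h0 hx)).add (hr _ (right_mem h0 hx))).mul_left _
  exact (hc y hy).sub (hc (1 / 2) (by norm_num))

theorem tentNorm_const_mul (c : ℂ) (g : ℝ → ℂ) (y : ℝ) :
    tentNorm κ (fun x => c * g x) y = c * tentNorm κ g y := by
  unfold tentNorm tentCont reflSum
  ring

/-- The resolvent of `tentNorm` on functions of bounded variation vanishing at `1/2`. -/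
theorem exists_tentNorm_resolvent (h0 : 0 ≤ κ) {z : ℂ} (hz : (2 + 2 * κ)⁻¹ < ‖z‖) {g : ℝ → ℂ}
    (hg : BoundedVariationOn g (Icc 0 1)) (hg0 : g (1 / 2) = 0) :
    ∃ u : ℝ → ℂ, BoundedVariationOn u (Icc 0 1) ∧ u (1 / 2) = 0 ∧
      ∀ y ∈ Icc (0 : ℝ) 1, z * u y - tentNorm κ u y = g y := by
  have hs : (0 : ℝ) < 2 + 2 * κ := by positivity
  have hzpos : 0 < ‖z‖ := (inv_pos.2 hs).trans hz
  have hz0 : z ≠ 0 := norm_pos_iff.1 hzpos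
  set V := (eVariationOn g (Icc 0 1)).toReal with hV
  set ρ := ‖z‖⁻¹ * (2 + 2 * κ)⁻¹ with hρ
  have hρ1 : ρ < 1 := by
    rw [hρ, inv_mul_lt_iff₀ hzpos, mul_one]
    exact hz
  have hρ0 : 0 ≤ ρ := by positivity
  have hgeo : Summable fun k : ℕ => ‖z‖⁻¹ * ρ ^ k :=
    (summable_geometric_of_lt_one hρ0 hρ1).mul_left _
  set F : ℕ → ℝ → ℂ := fun k y => z⁻¹ ^ (k + 1) * (tentNorm κ)^[k] g y with hFdef
  have hbound : ∀ y ∈ Icc (0 : ℝ) 1, ∀ k, ‖F k y‖ ≤ ‖z‖⁻¹ * ρ ^ k * V := by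
    intro y hy k
    rw [hFdef]
    simp only [norm_mul, norm_pow, norm_inv]
    calc ‖z‖⁻¹ ^ (k + 1) * _ ≤ ‖z‖⁻¹ ^ (k + 1) * ((2 + 2 * κ)⁻¹ ^ k * V) := by
          gcongr
          exact norm_iterate_tentNorm_le h0 hg hg0 k hy
      _ = _ := by rw [hρ, mul_pow, pow_succ]; ring
  have hsum : ∀ y ∈ Icc (0 : ℝ) 1, Summable fun k => F k y := fun y hy =>
    Summable.of_norm_bounded (hgeo.mul_right V) (hbound y hy)
  refine ⟨fun y => ∑' k, F k y, ?_, ?_, ?_⟩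
  · refine ne_top_of_le_ne_top ?_ (eVariationOn_tsum_le hsum)
    refine ne_top_of_le_ne_top (hgeo.mul_right V).tsum_ofReal_ne_top
      (ENNReal.tsum_le_tsum fun k => ?_)
    calc eVariationOn (F k) (Icc 0 1)
        ≤ ‖z⁻¹ ^ (k + 1)‖ₑ * eVariationOn ((tentNorm κ)^[k] g) (Icc 0 1) :=
          eVariationOn_const_mul_le _ _
      _ ≤ ENNReal.ofReal (‖z‖⁻¹ ^ (k + 1)) *
          (ENNReal.ofReal ((2 + 2 * κ)⁻¹ ^ k) * ENNReal.ofReal V) := by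
          rw [← ofReal_norm, norm_pow, norm_inv, hV, ENNReal.ofReal_toReal hg]
          gcongr
          exact eVariationOn_iterate_tentNorm_le h0 g k
      _ = ENNReal.ofReal (‖z‖⁻¹ * ρ ^ k * V) := by
          rw [← ENNReal.ofReal_mul (by positivity), ← ENNReal.ofReal_mul (by positivity)]
          congr 1
          rw [hρ, mul_pow, pow_succ]
          ring
  · simp only [hFdef, iterate_tentNorm_half hg0, mul_zero, tsum_zero]
  · intro y hy
    have h1 := hasSum_tentNorm h0 (F := F) (u := fun y => ∑' k, F k y)
      (fun y hy => (hsum y hy).hasSum) hy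
    have h2 : ∀ k, tentNorm κ (F k) y = z * F (k + 1) y := by
      intro k
      rw [hFdef]
      simp only
      rw [tentNorm_const_mul, ← Function.iterate_succ_apply' (tentNorm κ), ← mul_assoc]
      congr 1
      rw [pow_succ z⁻¹ (k + 1), mul_comm z, mul_assoc, inv_mul_cancel₀ hz0, mul_one]
    rw [← h1.tsum_eq]
    simp only [h2]
    rw [tsum_mul_left, ← mul_sub, (hsum y hy).tsum_eq_zero_add, add_sub_cancel_right]
    simp [hFdef, hz0]

theorem boundedVariationOn_indicator_Iio (c : ℝ) (a : ℂ) :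
    BoundedVariationOn ((Iio c).indicator fun _ => a) (Icc 0 1) := by
  have h : BoundedVariationOn ((Ici c).indicator fun _ => (1 : ℝ)) (Icc 0 1) := by
    refine MonotoneOn.boundedVariationOn (C := 1) ?_ ?_
    · intro x _ y _ hxy
      by_cases hx : x ∈ Ici c
      · rw [indicator_of_mem hx, indicator_of_mem (mem_Ici.2 (le_trans hx hxy))]
      · rw [indicator_of_notMem hx]
        exact indicator_nonneg (fun _ _ => zero_le_one) _
    · intro x _
      by_cases hx : x ∈ Ici c <;> simp [indicator, hx]
  have h1 := (Complex.isometry_ofReal.lipschitz.comp_boundedVariationOn h).const_smul_fun (-a)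
  have h2 := h1.add_fun (BoundedVariationOn.const_fun a)
  convert h2 using 1
  ext x
  by_cases hx : x < c
  · simp [indicator, hx, not_le.2 hx]
  · simp [indicator, hx, not_lt.1 hx]

theorem tentTransfer_one (y : ℝ) : tentTransfer κ (fun _ => 1) y =
    2 * ((2 + 2 * κ : ℝ) : ℂ)⁻¹ * (1 + (Iio κ).indicator (fun _ => 1) y) := by
  unfold tentTransfer reflSum
  by_cases hy : y ∈ Iio κ
  · rw [indicator_of_mem hy, indicator_of_mem hy]; ring
  · rw [indicator_of_notMem hy, indicator_of_notMem hy]; ring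

theorem tentTransfer_eq_sub_add (g : ℝ → ℂ) (c : ℂ) (y : ℝ) : tentTransfer κ g y =
    tentTransfer κ (fun x => g x - c) y + c * tentTransfer κ (fun _ => 1) y := by
  unfold tentTransfer reflSum
  by_cases hy : y ∈ Iio κ
  · simp only [indicator_of_mem hy]; ring
  · simp only [indicator_of_notMem hy]; ring

theorem BoundedVariationOn.tentTransfer (h0 : 0 ≤ κ) {g : ℝ → ℂ}
    (hg : BoundedVariationOn g (Icc 0 1)) : BoundedVariationOn (tentTransfer κ g) (Icc 0 1) := by
  have h1 : BoundedVariationOn (_root_.tentTransfer κ fun x => g x - g (1 / 2)) (Icc 0 1) := by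
    rw [tentTransfer_eq_tentCont h0 (sub_self _)]
    exact ne_top_of_le_ne_top (ENNReal.mul_ne_top ENNReal.ofReal_ne_top (hg.sub_const_fun _))
      (eVariationOn_tentCont_le h0 _)
  have h2 : BoundedVariationOn (_root_.tentTransfer κ fun _ => 1) (Icc 0 1) := by
    rw [funext (tentTransfer_one (κ := κ))]
    exact ((BoundedVariationOn.const_fun 1).add_fun
      (boundedVariationOn_indicator_Iio κ 1)).const_smul_fun _
  rw [funext (tentTransfer_eq_sub_add g (g (1 / 2)))]
  exact h1.add_fun (h2.const_smul_fun _)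

end Tent

theorem perronFrobenius_mem_bvSpace {κ : ℝ} (h0 : 0 ≤ κ) (h1 : κ ≤ 1) {f : Lp ℂ 1 lebI}
    (hf : f ∈ bvSpace) : perronFrobenius (factorTent_nonsingular h0 h1) f ∈ bvSpace := by
  obtain ⟨g, hfg, hg⟩ := hf
  exact ⟨tentTransfer κ g, perronFrobenius_ae_eq h0 h1 hfg, hg.tentTransfer h0⟩

theorem factorPF_mem_bvSpace (n : ℕ) : ∀ f ∈ bvSpace, factorPF n f ∈ bvSpace := fun _ hf =>
  perronFrobenius_mem_bvSpace (kappa_pos n).le (kappa_le_one n) hf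

/-- The Perron-Frobenius operator of the factor map, restricted to `BV`. -/
noncomputable def bvPF (n : ℕ) : Module.End ℂ bvSpace :=
  (factorPF n).restrict (factorPF_mem_bvSpace n)

theorem bvPF_ae_eq (n : ℕ) {f : bvSpace} {g : ℝ → ℂ} (hfg : (f : Lp ℂ 1 lebI) =ᵐ[lebI] g) :
    (bvPF n f : Lp ℂ 1 lebI) =ᵐ[lebI] tentTransfer (kappa n) g :=
  perronFrobenius_ae_eq (kappa_pos n).le (kappa_le_one n) hfg

/-- The element of `BV` represented by a function of bounded variation. -/
noncomputable def bvMk (g : ℝ → ℂ) (hg : BoundedVariationOn g (Icc 0 1)) : bvSpace :=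
  ⟨hg.integrable_lebI.toL1, g, hg.integrable_lebI.coeFn_toL1, hg⟩

theorem coe_bvMk (g : ℝ → ℂ) (hg : BoundedVariationOn g (Icc 0 1)) :
    (bvMk g hg : Lp ℂ 1 lebI) =ᵐ[lebI] g := hg.integrable_lebI.coeFn_toL1

theorem bvSpace_ext {f f' : bvSpace} {g g' : ℝ → ℂ} (h : (f : Lp ℂ 1 lebI) =ᵐ[lebI] g)
    (h' : (f' : Lp ℂ 1 lebI) =ᵐ[lebI] g') (hgg : ∀ y ∈ Icc (0 : ℝ) 1, g y = g' y) : f = f' := by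
  apply Subtype.ext
  apply Lp.ext
  have : g =ᵐ[lebI] g' := ae_restrict_of_forall_mem measurableSet_Icc hgg
  exact h.trans (this.trans h'.symm)

theorem bvSpace_coe_add {f f' : bvSpace} {g g' : ℝ → ℂ} (h : (f : Lp ℂ 1 lebI) =ᵐ[lebI] g)
    (h' : (f' : Lp ℂ 1 lebI) =ᵐ[lebI] g') :
    ((f + f' : bvSpace) : Lp ℂ 1 lebI) =ᵐ[lebI] fun y => g y + g' y :=
  (Lp.coeFn_add _ _).trans (h.add h')

theorem bvSpace_coe_smul {f : bvSpace} {g : ℝ → ℂ} (c : ℂ) (h : (f : Lp ℂ 1 lebI) =ᵐ[lebI] g) :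
    ((c • f : bvSpace) : Lp ℂ 1 lebI) =ᵐ[lebI] fun y => c * g y :=
  (Lp.coeFn_smul c _).trans (h.const_smul c)

/-- The constant function `1`. -/
noncomputable def bvOne : bvSpace := bvMk (fun _ => 1) (BoundedVariationOn.const_fun 1)

/-- The indicator function of `[0, c)`. -/
noncomputable def bvStep (c : ℝ) : bvSpace :=
  bvMk ((Iio c).indicator fun _ => 1) (boundedVariationOn_indicator_Iio c 1)

theorem coe_bvOne : (bvOne : Lp ℂ 1 lebI) =ᵐ[lebI] fun _ => 1 := coe_bvMk _ _

theorem coe_bvStep (c : ℝ) :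
    (bvStep c : Lp ℂ 1 lebI) =ᵐ[lebI] (Iio c).indicator fun _ => 1 := coe_bvMk _ _

/-- The integral as a linear functional on `BV`. -/
noncomputable def bvIntegral : bvSpace →ₗ[ℂ] ℂ where
  toFun f := ∫ x, (f : Lp ℂ 1 lebI) x ∂lebI
  map_add' f g := by
    rw [← integral_add (L1.integrable_coeFn _) (L1.integrable_coeFn _)]
    exact integral_congr_ae (Lp.coeFn_add _ _)
  map_smul' c f := by
    rw [RingHom.id_apply, ← integral_smul]
    exact integral_congr_ae (Lp.coeFn_smul c _)

theorem bvIntegral_bvPF (n : ℕ) (f : bvSpace) : bvIntegral (bvPF n f) = bvIntegral f :=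
  integral_perronFrobenius (kappa_pos n).le (kappa_le_one n) _

theorem bvIntegral_pow_bvPF (n k : ℕ) (f : bvSpace) :
    bvIntegral ((bvPF n ^ k) f) = bvIntegral f := by
  induction k with
  | zero => simp
  | succ k ih => rw [pow_succ', Module.End.mul_apply, bvIntegral_bvPF, ih]

theorem norm_bvIntegral_le (f : bvSpace) : ‖bvIntegral f‖ ≤ ‖f‖ := by
  change ‖∫ x, (f : Lp ℂ 1 lebI) x ∂lebI‖ ≤ ‖(f : Lp ℂ 1 lebI)‖
  rw [L1.norm_eq_integral_norm]
  exact norm_integral_le_integral_norm _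

theorem bvIntegral_bvOne : bvIntegral bvOne = 1 := by
  change ∫ x, (bvOne : Lp ℂ 1 lebI) x ∂lebI = 1
  rw [integral_congr_ae coe_bvOne]
  simp

theorem norm_bvMk_le {g : ℝ → ℂ} (hg : BoundedVariationOn g (Icc 0 1)) {M : ℝ}
    (hM : ∀ y ∈ Icc (0 : ℝ) 1, ‖g y‖ ≤ M) : ‖bvMk g hg‖ ≤ M := by
  change ‖(bvMk g hg : Lp ℂ 1 lebI)‖ ≤ M
  have h : (fun x => ‖(bvMk g hg : Lp ℂ 1 lebI) x‖) =ᵐ[lebI] fun x => ‖g x‖ :=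
    (coe_bvMk g hg).fun_comp norm
  rw [L1.norm_eq_integral_norm, integral_congr_ae h]
  calc ∫ x, ‖g x‖ ∂lebI ≤ ∫ _, M ∂lebI :=
        integral_mono_ae hg.integrable_lebI.norm (integrable_const M)
          (ae_restrict_of_forall_mem measurableSet_Icc hM)
    _ = M := by simp

theorem bvPF_bvMk (n : ℕ) {g : ℝ → ℂ} (hg : BoundedVariationOn g (Icc 0 1))
    (hg0 : g (1 / 2) = 0) (hg' : BoundedVariationOn (tentNorm (kappa n) g) (Icc 0 1)) :
    bvPF n (bvMk g hg) = bvMk (tentNorm (kappa n) g) hg' +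
      tentCont (kappa n) g (1 / 2) • bvOne := by
  refine bvSpace_ext (bvPF_ae_eq n (coe_bvMk g hg))
    (bvSpace_coe_add (coe_bvMk _ _) (bvSpace_coe_smul _ (coe_bvMk _ _))) fun y _ => ?_
  rw [tentTransfer_eq_tentCont (kappa_pos n).le hg0, tentNorm]
  ring

theorem exists_eq_bvMk_add (f : bvSpace) {g : ℝ → ℂ} (hfg : (f : Lp ℂ 1 lebI) =ᵐ[lebI] g)
    (hg : BoundedVariationOn g (Icc 0 1)) :
    f = bvMk (fun x => g x - g (1 / 2)) (hg.sub_const_fun _) + g (1 / 2) • bvOne := by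
  refine bvSpace_ext hfg
    (bvSpace_coe_add (coe_bvMk _ _) (bvSpace_coe_smul _ (coe_bvMk _ _))) fun y _ => ?_
  ring

theorem norm_pow_le_of_cascade {E : Type*} [NormedAddCommGroup E] [NormedSpace ℂ E]
    (Q : Module.End ℂ E) {b : ℕ → E} {c : ℕ → ℂ} {d : E} {A B K σ β : ℝ} (hσ : 0 ≤ σ)
    (hσβ : σ < β) (hQ : ∀ i, Q (b i) = b (i + 1) + c i • d) (hb : ∀ i, ‖b i‖ ≤ B * σ ^ i)
    (hc : ∀ i, ‖c i‖ ≤ A * σ ^ i) (hd : ∀ k, ‖(Q ^ k) d‖ ≤ K * β ^ k) (k i : ℕ) :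
    ‖(Q ^ k) (b i)‖ ≤ max B (A * K / (β - σ)) * σ ^ i * β ^ k := by
  set M := max B (A * K / (β - σ)) with hM
  have hA : 0 ≤ A := by simpa using (norm_nonneg _).trans (hc 0)
  have hβ : 0 ≤ β := hσ.trans hσβ.le
  induction k generalizing i with
  | zero =>
    simpa using (hb i).trans (mul_le_mul_of_nonneg_right (le_max_left _ _) (pow_nonneg hσ i))
  | succ k ih =>
    have h1 : A * K ≤ M * (β - σ) := (div_le_iff₀ (sub_pos.2 hσβ)).1 (le_max_right _ _)
    calc ‖(Q ^ (k + 1)) (b i)‖ = ‖(Q ^ k) (b (i + 1)) + c i • (Q ^ k) d‖ := by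
          rw [pow_succ, Module.End.mul_apply, hQ, map_add, map_smul]
      _ ≤ M * σ ^ (i + 1) * β ^ k + A * σ ^ i * (K * β ^ k) := by
          refine (norm_add_le _ _).trans (add_le_add (ih _) ?_)
          rw [norm_smul]
          exact mul_le_mul (hc i) (hd k) (norm_nonneg _) (by positivity)
      _ = (M * σ + A * K) * (σ ^ i * β ^ k) := by ring
      _ ≤ (M * β) * (σ ^ i * β ^ k) := by gcongr; linarith
      _ = _ := by ring

section Invariant

/-- The step functions in the orbit of `1_{[0, κ)}`. -/
noncomputable def stepOrbit (κ : ℝ) : ℕ → ℝ → ℂ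
  | 0 => (Iio κ).indicator fun _ => 1
  | j + 1 => (Ioi (1 - (2 + 2 * κ) ^ (j + 1) * κ)).indicator fun _ => 1

theorem pow_mul_kappa_le_one {n j : ℕ} (hj : j ≤ n) : (2 + 2 * kappa n) ^ j * kappa n ≤ 1 := by
  have hκ := kappa_pos n
  rw [← kappa_eq n]
  gcongr
  linarith

theorem tentTransfer_stepOrbit {n j : ℕ} (hj : j < n) {y : ℝ} (hy : y ∈ Icc (0 : ℝ) 1) :
    tentTransfer (kappa n) (stepOrbit (kappa n) j) y =
      ((2 + 2 * kappa n : ℝ) : ℂ)⁻¹ * stepOrbit (kappa n) (j + 1) y := by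
  have hκ := kappa_pos n
  have hκ2 : kappa n < 1 / 2 := kappa_lt_half (by omega)
  have hp := pow_mul_kappa_le_one (n := n) (j := j + 1) (by omega)
  set κ := kappa n
  have hs : (0 : ℝ) < 2 + 2 * κ := by positivity
  obtain ⟨hy0, hy1⟩ := hy
  unfold tentTransfer
  congr 1
  set a := (1 - y) / (2 + 2 * κ) with ha
  have ha' : a * (2 + 2 * κ) = 1 - y := div_mul_cancel₀ _ hs.ne'
  have ha2 : a ≤ 1 / 2 := by nlinarith
  have hb' : (1 + y) / (2 + 2 * κ) * (2 + 2 * κ) = 1 + y := div_mul_cancel₀ _ hs.ne'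
  set b := (1 + y) / (2 + 2 * κ) with hb
  have ind : ∀ (P : Prop) [Decidable P] (S : Set ℝ) (x : ℝ), (x ∈ S ↔ P) →
      S.indicator (fun _ => (1 : ℂ)) x = if P then 1 else 0 := by
    intro P _ S x h
    by_cases hP : P
    · rw [if_pos hP, indicator_of_mem (h.2 hP)]
    · rw [if_neg hP, indicator_of_notMem (h.not.2 hP)]
  rcases j with _ | j
  · have h1 : (Iio κ).indicator
        (fun y => reflSum (stepOrbit κ 0) ((1 + y) / (2 + 2 * κ))) y = 0 := by
      by_cases hyκ : y ∈ Iio κ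
      · rw [indicator_of_mem hyκ]
        change y < κ at hyκ
        simp only [reflSum, stepOrbit, ← hb]
        rw [ind False, ind False]
        · simp
        · simp only [mem_Iio, iff_false, not_lt]; nlinarith
        · simp only [mem_Iio, iff_false, not_lt]
          rw [zero_add, pow_one] at hp
          by_contra! h
          nlinarith
      · rw [indicator_of_notMem hyκ]
    rw [h1, add_zero]
    simp only [reflSum, stepOrbit]
    rw [ind (1 - (2 + 2 * κ) * κ < y) (Iio κ) a, ind False (Iio κ) (1 - a),
      ind (1 - (2 + 2 * κ) * κ < y)]
    · simp
    · simp
    · simp only [mem_Iio, iff_false, not_lt]; linarith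
    · simp only [mem_Iio]
      constructor <;> intro h <;> nlinarith
  · set c := (2 + 2 * κ) ^ (j + 1) * κ with hc
    have hcs : (2 + 2 * κ) ^ (j + 1 + 1) * κ = c * (2 + 2 * κ) := by rw [hc]; ring
    rw [hcs] at hp
    have hc2 : c ≤ 1 / 2 := by nlinarith
    have h1 : (Iio κ).indicator
        (fun y => reflSum (stepOrbit κ (j + 1)) ((1 + y) / (2 + 2 * κ))) y = 0 := by
      by_cases hyκ : y ∈ Iio κ
      · rw [indicator_of_mem hyκ]
        change y < κ at hyκ
        simp only [reflSum, stepOrbit, ← hb, ← hc]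
        rw [ind False, ind False]
        · simp
        · simp only [mem_Ioi, iff_false, not_lt]
          by_contra! h
          nlinarith
        · simp only [mem_Ioi, iff_false, not_lt]; nlinarith
      · rw [indicator_of_notMem hyκ]
    rw [h1, add_zero]
    simp only [reflSum, stepOrbit, ← hc, hcs]
    rw [ind False (Ioi (1 - c)) a, ind (1 - c * (2 + 2 * κ) < y) (Ioi (1 - c)) (1 - a),
      ind (1 - c * (2 + 2 * κ) < y)]
    · simp
    · simp
    · simp only [mem_Ioi]
      constructor <;> intro h <;> nlinarith
    · simp only [mem_Ioi, iff_false, not_lt]; linarith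

theorem coe_pow_bvPF_bvStep {n j : ℕ} (hj : j ≤ n) :
    ((bvPF n ^ j) (bvStep (kappa n)) : Lp ℂ 1 lebI) =ᵐ[lebI]
      fun y => ((2 + 2 * kappa n : ℝ) : ℂ)⁻¹ ^ j * stepOrbit (kappa n) j y := by
  induction j with
  | zero =>
    simp only [pow_zero, one_mul]
    exact coe_bvStep _
  | succ j ih =>
    have h := bvPF_ae_eq n (ih (by omega))
    rw [← Module.End.mul_apply, ← pow_succ'] at h
    refine h.trans (ae_restrict_of_forall_mem measurableSet_Icc fun y hy => ?_)
    have e : tentTransfer (kappa n) (fun y => ((2 + 2 * kappa n : ℝ) : ℂ)⁻¹ ^ j *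
        stepOrbit (kappa n) j y) y = ((2 + 2 * kappa n : ℝ) : ℂ)⁻¹ ^ j *
        tentTransfer (kappa n) (stepOrbit (kappa n) j) y := by
      unfold tentTransfer reflSum
      by_cases hy : y ∈ Iio (kappa n)
      · simp only [indicator_of_mem hy]; ring
      · simp only [indicator_of_notMem hy]; ring
    rw [e, tentTransfer_stepOrbit (by omega) hy, pow_succ]
    ring

theorem pow_bvPF_bvStep {n : ℕ} (hn : 1 ≤ n) :
    (bvPF n ^ n) (bvStep (kappa n)) = (kappa n : ℂ) • bvOne := by
  apply Subtype.ext
  apply Lp.ext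
  refine (coe_pow_bvPF_bvStep le_rfl).trans
    (Filter.EventuallyEq.trans ?_ (bvSpace_coe_smul _ coe_bvOne).symm)
  have h0 : ∀ᵐ y ∂lebI, y ≠ 0 := by
    rw [lebI]
    exact ae_restrict_of_ae (by simp [ae_iff])
  have hmem : ∀ᵐ y ∂lebI, y ∈ Icc (0 : ℝ) 1 := ae_restrict_mem measurableSet_Icc
  filter_upwards [h0, hmem] with y hy hy'
  obtain ⟨m, rfl⟩ : ∃ m, n = m + 1 := ⟨n - 1, by omega⟩
  have hpos : 0 < y := lt_of_le_of_ne hy'.1 (Ne.symm hy)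
  have hk := kappa_eq (m + 1)
  have hs : ((2 + 2 * kappa (m + 1) : ℝ) : ℂ) ≠ 0 := by
    have := kappa_pos (m + 1)
    exact_mod_cast (by positivity : (2 + 2 * kappa (m + 1) : ℝ) ≠ 0)
  rw [stepOrbit, indicator_of_mem, inv_pow, mul_one, mul_one, inv_eq_iff_eq_inv]
  · apply eq_inv_of_mul_eq_one_left
    exact_mod_cast hk
  · rw [hk, sub_self]
    exact hpos

theorem bvPF_bvOne (n : ℕ) : bvPF n bvOne =
    (2 * ((2 + 2 * kappa n : ℝ) : ℂ)⁻¹) • (bvOne + bvStep (kappa n)) :=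
  bvSpace_ext (bvPF_ae_eq n (coe_bvMk _ _))
    (bvSpace_coe_smul _ (bvSpace_coe_add (coe_bvMk _ _) (coe_bvMk _ _)))
    fun y _ => tentTransfer_one y

end Invariant

section Polynomial

open Polynomial

variable (n : ℕ)

/-- The polynomial whose roots are the eigenvalues other than `1` on the span of the orbit
of the constant function. -/
noncomputable def cyclicPoly : ℂ[X] :=
  X ^ n + ∑ j ∈ Finset.range n,
    C (2 * (kappa n : ℂ) * ((2 + 2 * kappa n : ℝ) : ℂ)⁻¹) * X ^ j

theorem ofReal_slope_ne_zero : ((2 + 2 * kappa n : ℝ) : ℂ) ≠ 0 := by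
  have := kappa_pos n
  exact_mod_cast (by positivity : (2 + 2 * kappa n : ℝ) ≠ 0)

theorem two_mul_inv_slope_mul :
    2 * ((2 + 2 * kappa n : ℝ) : ℂ)⁻¹ * ((1 + kappa n : ℝ) : ℂ) = 1 := by
  have hs := ofReal_slope_ne_zero n
  have e : ((2 + 2 * kappa n : ℝ) : ℂ) = 2 * ((1 + kappa n : ℝ) : ℂ) := by push_cast; ring
  rw [mul_right_comm, ← e, mul_inv_cancel₀ hs]

theorem monic_cyclicPoly : (cyclicPoly n).Monic := by
  refine monic_X_pow_add (mem_degreeLT.1 (Submodule.sum_mem _ fun j hj => mem_degreeLT.2 ?_))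
  refine (degree_C_mul_X_pow_le j _).trans_lt ?_
  exact_mod_cast Finset.mem_range.1 hj

theorem eval_cyclicPoly_mul (z : ℂ) : (z - 1) * (cyclicPoly n).eval z =
    z ^ n * (z - 1) + 2 * (kappa n : ℂ) * ((2 + 2 * kappa n : ℝ) : ℂ)⁻¹ * (z ^ n - 1) := by
  simp only [cyclicPoly, eval_add, eval_pow, eval_X, eval_finsetSum, eval_mul, eval_C]
  rw [← Finset.mul_sum, ← mul_geom_sum z n]
  ring

theorem eval_one_cyclicPoly : (cyclicPoly n).eval 1 =
    2 * ((2 + 2 * kappa n : ℝ) : ℂ)⁻¹ * ((n * kappa n + (1 + kappa n) : ℝ) : ℂ) := by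
  simp only [cyclicPoly, eval_add, eval_pow, eval_X, eval_finsetSum, eval_mul, eval_C, one_pow,
    mul_one, Finset.sum_const, Finset.card_range, nsmul_eq_mul]
  rw [Complex.ofReal_add (n * kappa n), mul_add, two_mul_inv_slope_mul, Complex.ofReal_mul,
    Complex.ofReal_natCast]
  ring

/-- The invariant vector, not normalised. -/
noncomputable def bvInvariant : bvSpace :=
  ∑ j ∈ Finset.range n, (bvPF n ^ j) (bvStep (kappa n)) + ((1 + kappa n : ℝ) : ℂ) • bvOne

variable {n}

theorem bvPF_bvInvariant (hn : 1 ≤ n) : bvPF n (bvInvariant n) = bvInvariant n := by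
  have h := Finset.sum_range_succ' (fun j => (bvPF n ^ j) (bvStep (kappa n))) n
  rw [Finset.sum_range_succ, pow_bvPF_bvStep hn, pow_zero, Module.End.one_apply] at h
  have h2 : ((1 + kappa n : ℝ) : ℂ) * (2 * ((2 + 2 * kappa n : ℝ) : ℂ)⁻¹) = 1 := by
    rw [mul_comm, two_mul_inv_slope_mul]
  unfold bvInvariant
  rw [map_add, map_smul, bvPF_bvOne, smul_smul, h2, one_smul, map_sum]
  simp only [← Module.End.mul_apply, ← pow_succ']
  rw [eq_sub_of_add_eq h.symm]
  push_cast
  module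

theorem aeval_cyclicPoly_bvStep (hn : 1 ≤ n) : aeval (bvPF n) (cyclicPoly n) (bvStep (kappa n)) =
    (2 * (kappa n : ℂ) * ((2 + 2 * kappa n : ℝ) : ℂ)⁻¹) • bvInvariant n := by
  have h2 : (2 * (kappa n : ℂ) * ((2 + 2 * kappa n : ℝ) : ℂ)⁻¹) * ((1 + kappa n : ℝ) : ℂ) =
      kappa n := by
    linear_combination (kappa n : ℂ) * two_mul_inv_slope_mul n
  rw [cyclicPoly]
  generalize 2 * (kappa n : ℂ) * ((2 + 2 * kappa n : ℝ) : ℂ)⁻¹ = c at h2 ⊢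
  simp only [map_add, map_pow, aeval_X, map_sum, map_mul, aeval_C,
    LinearMap.add_apply, LinearMap.sum_apply, Module.End.mul_apply, Module.algebraMap_end_apply]
  rw [pow_bvPF_bvStep hn, bvInvariant, smul_add, smul_smul, h2, Finset.smul_sum, add_comm]

theorem aeval_cyclicPoly_bvOne (hn : 1 ≤ n) : aeval (bvPF n) (cyclicPoly n) bvOne =
    (2 * ((2 + 2 * kappa n : ℝ) : ℂ)⁻¹) • bvInvariant n := by
  have hκ : (kappa n : ℂ) ≠ 0 := by exact_mod_cast (kappa_pos n).ne'
  have hfix : ∀ k : ℕ, (bvPF n ^ k) (bvInvariant n) = bvInvariant n := by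
    intro k
    induction k with
    | zero => simp
    | succ k ih => rw [pow_succ', Module.End.mul_apply, ih, bvPF_bvInvariant hn]
  have hcomm : aeval (bvPF n) (cyclicPoly n) ((bvPF n ^ n) (bvStep (kappa n))) =
      (bvPF n ^ n) (aeval (bvPF n) (cyclicPoly n) (bvStep (kappa n))) := by
    rw [← Module.End.mul_apply, ← Module.End.mul_apply]
    congr 1
    rw [show bvPF n ^ n = aeval (bvPF n) (X ^ n : ℂ[X]) by simp, ← map_mul, ← map_mul, mul_comm]
  rw [pow_bvPF_bvStep hn, aeval_cyclicPoly_bvStep hn, map_smul, map_smul, hfix] at hcomm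
  have := congrArg ((kappa n : ℂ)⁻¹ • ·) hcomm
  simp only [smul_smul] at this
  rw [inv_mul_cancel₀ hκ, one_smul] at this
  rw [this]
  congr 1
  field_simp

end Polynomial

section Density

variable {n : ℕ}

theorem bvIntegral_bvInvariant (hn : 1 ≤ n) :
    bvIntegral (bvInvariant n) = ((n * kappa n + (1 + kappa n) : ℝ) : ℂ) := by
  have h : bvIntegral (bvStep (kappa n)) = kappa n := by
    rw [← bvIntegral_pow_bvPF n n, pow_bvPF_bvStep hn, map_smul, bvIntegral_bvOne]
    simp
  rw [bvInvariant, map_add, map_sum, map_smul, bvIntegral_bvOne]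
  simp only [bvIntegral_pow_bvPF, h]
  simp

theorem invariantMass_pos (n : ℕ) : 0 < n * kappa n + (1 + kappa n) := by
  have := kappa_pos n
  positivity

/-- The invariant probability density. -/
noncomputable def bvDensity (n : ℕ) : bvSpace :=
  ((n * kappa n + (1 + kappa n) : ℝ) : ℂ)⁻¹ • bvInvariant n

theorem bvIntegral_bvDensity (hn : 1 ≤ n) : bvIntegral (bvDensity n) = 1 := by
  rw [bvDensity, map_smul, bvIntegral_bvInvariant hn, smul_eq_mul, inv_mul_cancel₀]
  exact_mod_cast (invariantMass_pos n).ne'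

theorem bvPF_bvDensity (hn : 1 ≤ n) : bvPF n (bvDensity n) = bvDensity n := by
  rw [bvDensity, map_smul, bvPF_bvInvariant hn]

theorem hasEigenvector_bvDensity (hn : 1 ≤ n) :
    Module.End.HasEigenvector (bvPF n) 1 (bvDensity n) := by
  refine ⟨Module.End.mem_eigenspace_iff.2 (by rw [one_smul, bvPF_bvDensity hn]), fun h0 => ?_⟩
  have := bvIntegral_bvDensity hn
  rw [h0, map_zero] at this
  exact zero_ne_one this

/-- The almost everywhere non-negative real elements of `BV`. -/
def IsNonnegBV (f : bvSpace) : Prop :=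
  ∀ᵐ x ∂lebI, ((f : Lp ℂ 1 lebI) x).im = 0 ∧ 0 ≤ ((f : Lp ℂ 1 lebI) x).re

theorem IsNonnegBV.add {f g : bvSpace} (hf : IsNonnegBV f) (hg : IsNonnegBV g) :
    IsNonnegBV (f + g) := by
  filter_upwards [hf, hg, Lp.coeFn_add (f : Lp ℂ 1 lebI) g] with x h1 h2 h3
  rw [Submodule.coe_add, h3, Pi.add_apply, Complex.add_im, Complex.add_re, h1.1, h2.1]
  exact ⟨add_zero 0, add_nonneg h1.2 h2.2⟩

theorem IsNonnegBV.smul {f : bvSpace} (hf : IsNonnegBV f) {c : ℝ} (hc : 0 ≤ c) :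
    IsNonnegBV ((c : ℂ) • f) := by
  filter_upwards [hf, Lp.coeFn_smul (c : ℂ) (f : Lp ℂ 1 lebI)] with x h1 h3
  rw [Submodule.coe_smul, h3, Pi.smul_apply, smul_eq_mul, Complex.im_ofReal_mul,
    Complex.re_ofReal_mul, h1.1]
  exact ⟨mul_zero c, mul_nonneg hc h1.2⟩

theorem isNonnegBV_of_ae_eq {f : bvSpace} {g : ℝ → ℝ}
    (h : (f : Lp ℂ 1 lebI) =ᵐ[lebI] fun x => (g x : ℂ)) (hg : ∀ x, 0 ≤ g x) : IsNonnegBV f := by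
  filter_upwards [h] with x hx
  rw [hx]
  exact ⟨Complex.ofReal_im _, hg x⟩

theorem stepOrbit_eq_zero_or_one (κ : ℝ) (j : ℕ) (y : ℝ) :
    stepOrbit κ j y = 0 ∨ stepOrbit κ j y = 1 := by
  cases j <;> exact indicator_eq_zero_or_self _ (fun _ => (1 : ℂ)) y

theorem isNonnegBV_pow_bvPF_bvStep {j : ℕ} (hj : j ≤ n) :
    IsNonnegBV ((bvPF n ^ j) (bvStep (kappa n))) := by
  have hκ := kappa_pos n
  refine isNonnegBV_of_ae_eq (g := fun y => (2 + 2 * kappa n)⁻¹ ^ j * (stepOrbit (kappa n) j y).re)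
    ((coe_pow_bvPF_bvStep hj).trans (Filter.Eventually.of_forall fun y => ?_)) fun y => ?_
  · rcases stepOrbit_eq_zero_or_one (kappa n) j y with h | h <;> simp [h]
  · rcases stepOrbit_eq_zero_or_one (kappa n) j y with h | h
    · simp [h]
    · simp only [h, Complex.one_re, mul_one]
      positivity

theorem isNonnegBV_bvDensity (n : ℕ) : IsNonnegBV (bvDensity n) := by
  have hκ := kappa_pos n
  have hone : IsNonnegBV bvOne :=
    isNonnegBV_of_ae_eq (g := fun _ => 1) (by simpa using coe_bvOne) fun _ => zero_le_one
  have hzero : IsNonnegBV 0 := by simpa using hone.smul (le_refl (0 : ℝ))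
  have hsum : ∀ m ≤ n,
      IsNonnegBV (∑ j ∈ Finset.range m, (bvPF n ^ j) (bvStep (kappa n))) := by
    intro m hm
    induction m with
    | zero => simpa using hzero
    | succ m ih =>
      rw [Finset.sum_range_succ]
      exact (ih (by omega)).add (isNonnegBV_pow_bvPF_bvStep (by omega))
  have h := ((hsum n le_rfl).add (hone.smul (by positivity : 0 ≤ 1 + kappa n))).smul
    (inv_nonneg.2 (invariantMass_pos n).le)
  rw [Complex.ofReal_inv] at h
  exact h

end Density

section Decay

open Polynomial

variable {n : ℕ}

theorem slope_pow_succ (n : ℕ) : (2 + 2 * kappa n) ^ (n + 1) = 2 * (2 + 2 * kappa n) ^ n + 2 := by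
  linear_combination 2 * kappa_eq n

/-- The rate `β_n`. -/
noncomputable def rate (n : ℕ) : ℝ := (1 + 1 / (n : ℝ)) / (2 + 2 * kappa n)

theorem inv_slope_lt_rate (hn : 1 ≤ n) : (2 + 2 * kappa n)⁻¹ < rate n := by
  have hκ := kappa_pos n
  have : (0 : ℝ) < n := by exact_mod_cast hn
  rw [rate, inv_eq_one_div]
  gcongr
  simp [this]

theorem rate_pos (n : ℕ) : 0 < rate n := by
  have hκ := kappa_pos n
  unfold rate
  positivity

theorem rate_le (hn : 6 ≤ n) : rate n ≤ 7 / 12 := by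
  have hκ := kappa_pos n
  have h6 : (6 : ℝ) ≤ n := by exact_mod_cast hn
  have hinv : 1 / (n : ℝ) ≤ 1 / 6 := by gcongr
  rw [rate, div_le_iff₀ (by positivity)]
  linarith

theorem eval_cyclicPoly_ne_zero (hn : 6 ≤ n) {z : ℂ} (hz : rate n ≤ ‖z‖) :
    (cyclicPoly n).eval z ≠ 0 := by
  intro h0
  have hκ := kappa_pos n
  have hs := ofReal_slope_ne_zero n
  have h6 : (6 : ℝ) ≤ n := by exact_mod_cast hn
  have hinv : 1 / (n : ℝ) ≤ 1 / 6 := by gcongr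
  have hs' : (0 : ℝ) < 2 + 2 * kappa n := by positivity
  have hprod := eval_cyclicPoly_mul n z
  have hk : ((2 + 2 * kappa n : ℝ) : ℂ) ^ n * kappa n = 1 := by exact_mod_cast kappa_eq n
  have hs2 : ((2 + 2 * kappa n : ℝ) : ℂ) = 2 + 2 * (kappa n : ℂ) := by push_cast; ring
  rw [h0, mul_zero] at hprod
  set S := ((2 + 2 * kappa n : ℝ) : ℂ) with hS
  set K := (kappa n : ℂ)
  have hroot : (S * z) ^ (n + 1) = 2 * (S * z) ^ n + 2 := by
    have h1 : S * (z ^ n * (z - 1)) + 2 * K * (z ^ n - 1) = 0 := by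
      have : S * (z ^ n * (z - 1) + 2 * K * S⁻¹ * (z ^ n - 1)) = 0 := by rw [← hprod, mul_zero]
      rw [← this]
      field_simp
    rw [mul_pow, mul_pow]
    linear_combination S ^ n * h1 + 2 * hk + S ^ n * z ^ n * hs2
  have hnorm : 1 + 1 / (n : ℝ) ≤ ‖S * z‖ := by
    rw [norm_mul, hS, Complex.norm_of_nonneg hs'.le]
    rwa [rate, div_le_iff₀' hs'] at hz
  have hroot' : S ^ (n + 1) = 2 * S ^ n + 2 := by
    rw [hS]
    exact_mod_cast slope_pow_succ n
  have hnorm' : 1 + 1 / (n : ℝ) ≤ ‖S‖ := by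
    rw [hS, Complex.norm_of_nonneg hs'.le]
    linarith
  have hz1 : z = 1 :=
    mul_left_cancel₀ hs ((root_unique hn hroot hroot' hnorm hnorm').trans (mul_one S).symm)
  rw [hz1, eval_one_cyclicPoly] at h0
  have hm : ((n * kappa n + (1 + kappa n) : ℝ) : ℂ) ≠ 0 := by
    exact_mod_cast (invariantMass_pos n).ne'
  exact mul_ne_zero (mul_ne_zero two_ne_zero (inv_ne_zero hs)) hm h0

theorem aeval_cyclicPoly_bvOne_sub (hn : 1 ≤ n) :
    aeval (bvPF n) (cyclicPoly n) (bvOne - bvDensity n) = 0 := by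
  have hm : ((n * kappa n + (1 + kappa n) : ℝ) : ℂ) ≠ 0 := by
    exact_mod_cast (invariantMass_pos n).ne'
  have h : aeval (bvPF n) (cyclicPoly n) (bvDensity n) =
      (cyclicPoly n).eval 1 • bvDensity n :=
    Module.End.aeval_apply_of_hasEigenvector (hasEigenvector_bvDensity hn)
  rw [map_sub, h, aeval_cyclicPoly_bvOne hn, eval_one_cyclicPoly, bvDensity, smul_smul, mul_assoc,
    mul_inv_cancel₀ hm, mul_one, sub_self]

theorem exists_norm_pow_bvOne_sub_le (hn : 6 ≤ n) :
    ∃ K : ℝ, 0 ≤ K ∧ ∀ m : ℕ, ‖(bvPF n ^ m) (bvOne - bvDensity n)‖ ≤ K * rate n ^ m :=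
  exists_norm_pow_le_of_monic (bvPF n) (rate_pos n) (monic_cyclicPoly n)
    (fun a ha => by
      by_contra! h
      exact eval_cyclicPoly_ne_zero hn h ha)
    _ (aeval_cyclicPoly_bvOne_sub (by omega))

/-- The projection along the invariant density onto functions of mean zero. -/
noncomputable def bvCenter (n : ℕ) : Module.End ℂ bvSpace :=
  LinearMap.id - bvIntegral.smulRight (bvDensity n)

theorem bvCenter_apply (n : ℕ) (f : bvSpace) :
    bvCenter n f = f - bvIntegral f • bvDensity n := rfl

theorem norm_bvCenter_le (n : ℕ) (f : bvSpace) :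
    ‖bvCenter n f‖ ≤ (1 + ‖bvDensity n‖) * ‖f‖ := by
  rw [bvCenter_apply]
  refine (norm_sub_le _ _).trans ?_
  rw [norm_smul]
  nlinarith [norm_bvIntegral_le f, norm_nonneg (bvDensity n), norm_nonneg f]

theorem bvPF_bvCenter (hn : 1 ≤ n) (f : bvSpace) :
    bvPF n (bvCenter n f) = bvCenter n (bvPF n f) := by
  rw [bvCenter_apply, bvCenter_apply, map_sub, map_smul, bvPF_bvDensity hn, bvIntegral_bvPF]

theorem pow_bvPF_bvCenter (hn : 1 ≤ n) (k : ℕ) (f : bvSpace) :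
    (bvPF n ^ k) (bvCenter n f) = (bvPF n ^ k) f - bvIntegral f • bvDensity n := by
  induction k with
  | zero => rfl
  | succ k ih =>
    rw [pow_succ', Module.End.mul_apply, ih, map_sub, map_smul, bvPF_bvDensity hn,
      Module.End.mul_apply]

theorem exists_norm_pow_bvCenter_bvMk_le (hn : 6 ≤ n) : ∃ K : ℝ, 0 ≤ K ∧
    ∀ (g : ℝ → ℂ) (hg : BoundedVariationOn g (Icc 0 1)), g (1 / 2) = 0 → ∀ k : ℕ,
      ‖(bvPF n ^ k) (bvCenter n (bvMk g hg))‖ ≤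
        K * rate n ^ k * (eVariationOn g (Icc 0 1)).toReal := by
  obtain ⟨K, hK, hd⟩ := exists_norm_pow_bvOne_sub_le hn
  have hκ := kappa_pos n
  have hσβ := inv_slope_lt_rate (n := n) (by omega)
  refine ⟨(1 + ‖bvDensity n‖) + 2 * K / (rate n - (2 + 2 * kappa n)⁻¹), ?_, ?_⟩
  · have := sub_pos.2 hσβ
    positivity
  intro g hg hg0 k
  set V := (eVariationOn g (Icc 0 1)).toReal with hV
  have hV0 : 0 ≤ V := ENNReal.toReal_nonneg
  have hbv := fun i => hg.iterate_tentNorm hκ.le i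
  have hval := fun i (y : ℝ) (hy : y ∈ Icc (0 : ℝ) 1) =>
    norm_iterate_tentNorm_le hκ.le hg hg0 i hy
  have h := norm_pow_le_of_cascade (bvPF n) (σ := (2 + 2 * kappa n)⁻¹) (β := rate n)
    (B := (1 + ‖bvDensity n‖) * V) (A := 2 * V) (K := K)
    (b := fun i => bvCenter n (bvMk ((tentNorm (kappa n))^[i] g) (hbv i)))
    (c := fun i => tentCont (kappa n) ((tentNorm (kappa n))^[i] g) (1 / 2))
    (d := bvOne - bvDensity n) (by positivity) hσβ ?_ ?_ ?_ hd k 0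
  · refine h.trans ?_
    have hr := rate_pos n
    have hp := sub_pos.2 hσβ
    rw [pow_zero, mul_one, show ((1 + ‖bvDensity n‖) + 2 * K / (rate n - (2 + 2 * kappa n)⁻¹)) *
      rate n ^ k * V = ((1 + ‖bvDensity n‖) * V + 2 * V * K / (rate n - (2 + 2 * kappa n)⁻¹)) *
      rate n ^ k by ring]
    gcongr
    exact max_le_add_of_nonneg (by positivity) (by positivity)
  · intro i
    have e : ∀ hx, bvMk ((tentNorm (kappa n))^[i + 1] g) hx =
        bvMk (tentNorm (kappa n) ((tentNorm (kappa n))^[i] g))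
          (by rwa [Function.iterate_succ_apply'] at hx) := by
      intro hx
      congr 1
      exact Function.iterate_succ_apply' _ _ _
    rw [bvPF_bvCenter (by omega), bvPF_bvMk n (hbv i) (iterate_tentNorm_half hg0 i)
      (by simpa only [Function.iterate_succ_apply'] using hbv (i + 1)), map_add, map_smul, e,
      bvCenter_apply n bvOne, bvIntegral_bvOne, one_smul]
  · intro i
    refine (norm_bvCenter_le n _).trans ?_
    rw [mul_assoc]
    gcongr
    exact norm_bvMk_le (hbv i) fun y hy => (hval i y hy).trans_eq (mul_comm _ _)
  · intro i
    refine (norm_tentCont_le hκ.le (hval i) (by norm_num)).trans_eq ?_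
    ring

theorem exists_norm_pow_sub_le_of_representative (hn : 6 ≤ n) : ∃ K : ℝ, 0 < K ∧
    ∀ (f : bvSpace) (g : ℝ → ℂ), (f : Lp ℂ 1 lebI) =ᵐ[lebI] g →
      BoundedVariationOn g (Icc 0 1) → ∀ k : ℕ,
      ‖(bvPF n ^ k) (bvCenter n f)‖ ≤
        K * rate n ^ k * (‖f‖ + (eVariationOn g (Icc 0 1)).toReal) := by
  obtain ⟨K₁, hK₁, h1⟩ := exists_norm_pow_bvOne_sub_le hn
  obtain ⟨K₂, hK₂, h2⟩ := exists_norm_pow_bvCenter_bvMk_le hn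
  refine ⟨K₁ + K₂ + 1, by positivity, fun f g hfg hg k => ?_⟩
  have hr := rate_pos n
  set V := (eVariationOn g (Icc 0 1)).toReal with hV
  have hV0 : 0 ≤ V := ENNReal.toReal_nonneg
  have hg' := hg.sub_const_fun (g (1 / 2))
  have hVeq : (eVariationOn (fun x => g x - g (1 / 2)) (Icc 0 1)).toReal = V := by
    rw [eVariationOn_sub_const]
  have hf := exists_eq_bvMk_add f hfg hg
  have hval : ‖g (1 / 2)‖ ≤ ‖f‖ + V := by
    have h1 : 1 ≤ ‖bvOne‖ := by simpa [bvIntegral_bvOne] using norm_bvIntegral_le bvOne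
    have h3 : ‖bvMk _ hg'‖ ≤ V := norm_bvMk_le hg' fun y hy => by
      rw [← hVeq]
      exact hg'.norm_le_of_eq_zero hy (by norm_num : (1 / 2 : ℝ) ∈ Icc (0 : ℝ) 1) (sub_self _)
    calc ‖g (1 / 2)‖ ≤ ‖g (1 / 2)‖ * ‖bvOne‖ := le_mul_of_one_le_right (norm_nonneg _) h1
      _ = ‖f - bvMk _ hg'‖ := by rw [← norm_smul, eq_sub_of_add_eq' hf.symm]
      _ ≤ ‖f‖ + V := (norm_sub_le _ _).trans (by gcongr)
  have hone : bvCenter n bvOne = bvOne - bvDensity n := by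
    rw [bvCenter_apply, bvIntegral_bvOne, one_smul]
  calc ‖(bvPF n ^ k) (bvCenter n f)‖
      = ‖(bvPF n ^ k) (bvCenter n (bvMk _ hg')) +
          g (1 / 2) • (bvPF n ^ k) (bvOne - bvDensity n)‖ := by
        rw [← hone, ← map_smul, ← map_smul, ← map_add, ← map_add, ← hf]
    _ ≤ K₂ * rate n ^ k * V + (‖f‖ + V) * (K₁ * rate n ^ k) := by
        refine (norm_add_le _ _).trans (add_le_add ?_ ?_)
        · rw [← hVeq]
          exact h2 _ hg' (sub_self _) k
        · rw [norm_smul]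
          exact mul_le_mul hval (h1 k) (norm_nonneg _) (by positivity)
    _ ≤ (K₁ + K₂ + 1) * rate n ^ k * (‖f‖ + V) := by
        have : 0 ≤ rate n ^ k * (K₂ * ‖f‖ + (‖f‖ + V)) := by positivity
        linarith

theorem exists_norm_pow_sub_le (hn : 6 ≤ n) : ∃ K : ℝ, 0 < K ∧ ∀ (f : bvSpace) (k : ℕ),
    ‖(bvPF n ^ k) (bvCenter n f)‖ ≤ K * rate n ^ k * bvNorm (f : Lp ℂ 1 lebI) := by
  obtain ⟨K, hK, h⟩ := exists_norm_pow_sub_le_of_representative hn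
  refine ⟨K, hK, fun f k => ?_⟩
  have hr := rate_pos n
  have hA : 0 < K * rate n ^ k := by positivity
  set X := ‖(bvPF n ^ k) (bvCenter n f)‖ / (K * rate n ^ k) - ‖f‖ with hX
  have hle : ENNReal.ofReal X ≤
      ⨅ (g : ℝ → ℂ) (_ : (f : Lp ℂ 1 lebI) =ᵐ[lebI] g), eVariationOn g (Icc 0 1) := by
    refine le_iInf₂ fun g hfg => ?_
    by_cases hg : eVariationOn g (Icc 0 1) = ⊤
    · rw [hg]; exact le_top
    · refine ENNReal.ofReal_le_of_le_toReal ?_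
      rw [hX, sub_le_iff_le_add', div_le_iff₀' hA]
      exact h f g hfg hg k
  have hfin : (⨅ (g : ℝ → ℂ) (_ : (f : Lp ℂ 1 lebI) =ᵐ[lebI] g), eVariationOn g (Icc 0 1)) ≠ ⊤ := by
    obtain ⟨g, hfg, hg⟩ := f.2
    exact ne_top_of_le_ne_top hg (iInf₂_le g hfg)
  have hX' := (ENNReal.ofReal_le_iff_le_toReal hfin).1 hle
  rw [hX, sub_le_iff_le_add', div_le_iff₀' hA] at hX'
  exact hX'

theorem bvCenter_eq_zero_of_fixed (hn : 6 ≤ n) {f : bvSpace} {z : ℂ} (hz : rate n < ‖z‖)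
    (h : bvPF n (bvCenter n f) = z • bvCenter n f) : bvCenter n f = 0 := by
  obtain ⟨K, hK, hb⟩ := exists_norm_pow_sub_le hn
  have hr := rate_pos n
  have hpow : ∀ k : ℕ, (bvPF n ^ k) (bvCenter n f) = z ^ k • bvCenter n f := by
    intro k
    induction k with
    | zero => simp
    | succ k ih => rw [pow_succ', Module.End.mul_apply, ih, map_smul, h, smul_smul, pow_succ]
  have hle : ∀ k : ℕ, ‖bvCenter n f‖ ≤ K * bvNorm (f : Lp ℂ 1 lebI) * (rate n / ‖z‖) ^ k := by
    intro k
    have h1 := hb f k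
    rw [hpow, norm_smul, norm_pow] at h1
    have hzk : 0 < ‖z‖ ^ k := pow_pos (hr.trans hz) k
    rw [div_pow, ← mul_div_assoc, le_div_iff₀ hzk]
    linarith
  have hlim : Filter.Tendsto (fun k : ℕ => K * bvNorm (f : Lp ℂ 1 lebI) * (rate n / ‖z‖) ^ k)
      Filter.atTop (nhds (K * bvNorm (f : Lp ℂ 1 lebI) * 0)) :=
    (tendsto_pow_atTop_nhds_zero_of_lt_one (div_nonneg hr.le (norm_nonneg z))
      ((div_lt_one (hr.trans hz)).2 hz)).const_mul _
  rw [mul_zero] at hlim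
  exact norm_eq_zero.1 (le_antisymm (ge_of_tendsto' hlim hle) (norm_nonneg _))

end Decay

section Spectrum

open Polynomial

variable {n : ℕ}

theorem bvCenter_eq_zero_of_pow_sub (hn : 6 ≤ n) (k : ℕ) (f : bvSpace)
    (h : ((bvPF n - (1 : ℂ) • 1) ^ k) f = 0) : bvCenter n f = 0 := by
  induction k generalizing f with
  | zero =>
    rw [pow_zero, Module.End.one_apply] at h
    rw [h, map_zero]
  | succ k ih =>
    rw [pow_succ, Module.End.mul_apply] at h
    have h1 := ih _ h
    rw [one_smul, LinearMap.sub_apply, Module.End.one_apply, map_sub, sub_eq_zero,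
      ← bvPF_bvCenter (by omega)] at h1
    refine bvCenter_eq_zero_of_fixed hn (z := 1) ?_ (by rw [h1, one_smul])
    rw [norm_one]
    linarith [rate_le hn]

theorem maxGenEigenspace_bvPF (hn : 6 ≤ n) :
    Module.End.maxGenEigenspace (bvPF n) 1 = Submodule.span ℂ {bvDensity n} := by
  apply le_antisymm
  · intro f hf
    obtain ⟨k, hk⟩ := Module.End.mem_maxGenEigenspace _ _ _ |>.1 hf
    have h := bvCenter_eq_zero_of_pow_sub hn k f hk
    rw [bvCenter_apply, sub_eq_zero] at h
    exact Submodule.mem_span_singleton.2 ⟨_, h.symm⟩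
  · rw [Submodule.span_singleton_le_iff_mem, Module.End.mem_maxGenEigenspace]
    refine ⟨1, ?_⟩
    rw [pow_one, one_smul, LinearMap.sub_apply, Module.End.one_apply,
      bvPF_bvDensity (by omega), sub_self]

theorem injective_sub_bvPF (hn : 6 ≤ n) {z : ℂ} (hz : rate n < ‖z‖) (hz1 : z ≠ 1) :
    Function.Injective (algebraMap ℂ (Module.End ℂ bvSpace) z - bvPF n) := by
  refine (injective_iff_map_eq_zero _).2 fun f hf => ?_
  rw [LinearMap.sub_apply, Module.algebraMap_end_apply, sub_eq_zero] at hf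
  have hint : bvIntegral f = 0 := by
    have h := congrArg bvIntegral hf
    rw [map_smul, bvIntegral_bvPF, smul_eq_mul] at h
    have : (z - 1) * bvIntegral f = 0 := by linear_combination h
    exact (mul_eq_zero.1 this).resolve_left (sub_ne_zero.2 hz1)
  have hc : bvCenter n f = f := by rw [bvCenter_apply, hint, zero_smul, sub_zero]
  rw [← hc]
  refine bvCenter_eq_zero_of_fixed hn hz ?_
  rw [hc, hf]

theorem bvOne_mem_range_sub_bvPF (hn : 6 ≤ n) {z : ℂ} (hz : rate n < ‖z‖) (hz1 : z ≠ 1) :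
    bvOne ∈ LinearMap.range (algebraMap ℂ (Module.End ℂ bvSpace) z - bvPF n) := by
  set p : ℂ[X] := (X - C 1) * cyclicPoly n with hp
  have hpz : p.eval z ≠ 0 := by
    rw [hp, eval_mul, eval_sub, eval_X, eval_C]
    exact mul_ne_zero (sub_ne_zero.2 hz1) (eval_cyclicPoly_ne_zero hn hz.le)
  have hp1 : aeval (bvPF n) p bvOne = 0 := by
    rw [hp, map_mul, Module.End.mul_apply, aeval_cyclicPoly_bvOne (by omega), map_smul, map_sub,
      aeval_X, aeval_C, LinearMap.sub_apply, Module.algebraMap_end_apply, one_smul,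
      bvPF_bvInvariant (by omega), sub_self, smul_zero]
  obtain ⟨t, ht⟩ := X_sub_C_dvd_sub_C_eval (a := z) (p := p)
  have h := congrArg (fun q => aeval (bvPF n) q bvOne) ht
  simp only [map_sub, map_mul, aeval_X, aeval_C, LinearMap.sub_apply, Module.End.mul_apply,
    hp1, Module.algebraMap_end_apply, zero_sub] at h
  refine ⟨(p.eval z)⁻¹ • aeval (bvPF n) t bvOne, ?_⟩
  rw [map_smul, LinearMap.sub_apply, Module.algebraMap_end_apply, ← neg_sub, ← h, neg_neg,
    inv_smul_smul₀ hpz]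

theorem surjective_sub_bvPF (hn : 6 ≤ n) {z : ℂ} (hz : rate n < ‖z‖) (hz1 : z ≠ 1) :
    Function.Surjective (algebraMap ℂ (Module.End ℂ bvSpace) z - bvPF n) := by
  rw [← LinearMap.range_eq_top, eq_top_iff]
  intro f _
  have hone := bvOne_mem_range_sub_bvPF hn hz hz1
  set T := algebraMap ℂ (Module.End ℂ bvSpace) z - bvPF n with hT
  have hκ := kappa_pos n
  obtain ⟨g, hfg, hg⟩ := f.2
  have hg' := hg.sub_const_fun (g (1 / 2))
  obtain ⟨u, hu, hu0, hres⟩ := exists_tentNorm_resolvent hκ.le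
    ((inv_slope_lt_rate (n := n) (by omega)).trans hz) hg' (sub_self _)
  have huN : BoundedVariationOn (tentNorm (kappa n) u) (Icc 0 1) := hu.iterate_tentNorm hκ.le 1
  have h1 : bvMk _ hg' = T (bvMk u hu) + tentCont (kappa n) u (1 / 2) • bvOne := by
    have h2 : z • bvMk u hu = bvMk _ hg' + bvMk _ huN :=
      bvSpace_ext (bvSpace_coe_smul z (coe_bvMk u hu))
        (bvSpace_coe_add (coe_bvMk _ hg') (coe_bvMk _ huN))
        fun y hy => by rw [← hres y hy]; ring
    rw [hT, LinearMap.sub_apply, Module.algebraMap_end_apply, bvPF_bvMk n hu hu0 huN, h2]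
    abel
  rw [exists_eq_bvMk_add f hfg hg, h1]
  exact add_mem (add_mem (LinearMap.mem_range_self _ _) (Submodule.smul_mem _ _ hone))
    (Submodule.smul_mem _ _ hone)

theorem norm_le_rate_of_mem_spectrum (hn : 6 ≤ n) {z : ℂ} (hz : z ∈ spectrum ℂ (bvPF n))
    (hz1 : z ≠ 1) : ‖z‖ ≤ rate n := by
  by_contra! h
  exact hz ((Module.End.isUnit_iff _).2
    ⟨injective_sub_bvPF hn h hz1, surjective_sub_bvPF hn h hz1⟩)

theorem secondModulus_bvPF_le (hn : 6 ≤ n) : secondModulus (bvPF n) ≤ rate n := by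
  refine Real.sSup_le ?_ (rate_pos n).le
  rintro r ⟨z, hz, hz1, rfl⟩
  exact norm_le_rate_of_mem_spectrum hn hz hz1

theorem mixingTime_bvPF_le (hn : 6 ≤ n) :
    mixingTime (bvPF n) ≤ 1 / |Real.log (7 / 12)| := by
  have hlog : Real.log (7 / 12) < 0 := Real.log_neg (by norm_num) (by norm_num)
  have h0 : 0 ≤ secondModulus (bvPF n) := by
    refine Real.sSup_nonneg ?_
    rintro r ⟨z, _, _, rfl⟩
    exact norm_nonneg z
  have h1 : secondModulus (bvPF n) ≤ 7 / 12 := (secondModulus_bvPF_le hn).trans (rate_le hn)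
  unfold mixingTime
  rcases h0.eq_or_lt with h | h
  · rw [← h, Real.log_zero, abs_zero, div_zero]
    positivity
  · have hle := Real.log_le_log h h1
    rw [abs_of_neg hlog, abs_of_neg (hle.trans_lt hlog)]
    exact one_div_le_one_div_of_le (by linarith) (by linarith)

theorem tendsto_kappa : Filter.Tendsto kappa Filter.atTop (nhds 0) := by
  refine squeeze_zero (fun n => (kappa_pos n).le) (fun n => ?_)
    (tendsto_pow_atTop_nhds_zero_of_lt_one (by norm_num : (0 : ℝ) ≤ 1 / 2) (by norm_num))
  have hκ := kappa_pos n
  have h2 : (2 : ℝ) ^ n ≤ (2 + 2 * kappa n) ^ n := by gcongr; linarith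
  rw [one_div, inv_pow, ← one_div, le_div_iff₀ (by positivity), ← kappa_eq n, mul_comm]
  gcongr

theorem isEquivalent_rate : Asymptotics.IsEquivalent Filter.atTop rate
    (fun n : ℕ => 1 / 2 * (1 + 1 / (n : ℝ))) := by
  have hlim : Filter.Tendsto (fun n => (1 + kappa n)⁻¹) Filter.atTop (nhds (1 + 0)⁻¹) :=
    (tendsto_const_nhds.add tendsto_kappa).inv₀ (by norm_num)
  rw [add_zero, inv_one] at hlim
  refine Asymptotics.isEquivalent_of_tendsto_one (hlim.congr fun n => ?_)
  have := kappa_pos n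
  have h1 : 1 + 1 / (n : ℝ) ≠ 0 := by positivity
  have h2 : 2 + 2 * kappa n = 2 * (1 + kappa n) := by ring
  have h3 : 1 + kappa n ≠ 0 := by positivity
  rw [Pi.div_apply, rate, h2]
  generalize 1 + 1 / (n : ℝ) = a at h1
  field_simp

end Spectrum

theorem mainTheorem5 :
    ∃ hBV : ∀ n : ℕ, ∀ f ∈ bvSpace, factorPF n f ∈ bvSpace,
      (∀ n : ℕ, 6 ≤ n →
        (∃ h : bvSpace,
          (∀ᵐ x ∂lebI, ((h : Lp ℂ 1 lebI) x).im = 0 ∧ 0 ≤ ((h : Lp ℂ 1 lebI) x).re) ∧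
          ∫ x, (h : Lp ℂ 1 lebI) x ∂lebI = 1 ∧
          Module.End.HasEigenvector ((factorPF n).restrict (hBV n)) 1 h ∧
          Module.End.maxGenEigenspace ((factorPF n).restrict (hBV n)) 1 =
            Submodule.span ℂ {h} ∧
          ∃ C : ℝ, ∀ f : bvSpace, ∀ k : ℕ,
            ‖((((factorPF n).restrict (hBV n)) ^ k) f : Lp ℂ 1 lebI) -
                (∫ x, (f : Lp ℂ 1 lebI) x ∂lebI) • (h : Lp ℂ 1 lebI)‖ ≤
              C * ((1 + 1 / (n : ℝ)) / (2 + 2 * kappa n)) ^ k * bvNorm (f : Lp ℂ 1 lebI)) ∧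
        (∀ z ∈ spectrum ℂ ((factorPF n).restrict (hBV n)), z ≠ 1 →
          ‖z‖ ≤ (1 + 1 / (n : ℝ)) / (2 + 2 * kappa n)) ∧
        secondModulus ((factorPF n).restrict (hBV n)) ≤
          (1 + 1 / (n : ℝ)) / (2 + 2 * kappa n)) ∧
      Asymptotics.IsEquivalent Filter.atTop
        (fun n : ℕ => (1 + 1 / (n : ℝ)) / (2 + 2 * kappa n))
        (fun n : ℕ => 1 / 2 * (1 + 1 / (n : ℝ))) ∧
      ∃ M : ℝ, ∀ n : ℕ, 6 ≤ n → mixingTime ((factorPF n).restrict (hBV n)) ≤ M := by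
  refine ⟨factorPF_mem_bvSpace, fun n hn => ⟨⟨bvDensity n, isNonnegBV_bvDensity n,
    bvIntegral_bvDensity (by omega), hasEigenvector_bvDensity (by omega),
    maxGenEigenspace_bvPF hn, ?_⟩, fun z hz hz1 => norm_le_rate_of_mem_spectrum hn hz hz1,
    secondModulus_bvPF_le hn⟩, isEquivalent_rate,
    1 / |Real.log (7 / 12)|, fun n hn => mixingTime_bvPF_le hn⟩
  obtain ⟨K, _, hK⟩ := exists_norm_pow_sub_le hn
  refine ⟨K, fun f k => ?_⟩
  have h := hK f k
  rw [pow_bvPF_bvCenter (by omega)] at h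
  exact h
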